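/- Let $\lambda\in\mathbb R$ and $\gamma\in(0,2)$ with $\gamma\ge\lambda^2/3$. Consider the planar system (flat FLRW cosmology with scalar-field potential $V=V_0e^{-\lambda\varphi}$, $V_0>0$, and a perfect fluid $p_{\rm pf}=(\gamma-1)\rho_{\rm pf}$; $'=d/dN$, $N$ the $e$-fold time) $$\Sigma_\varphi'=-(2-q)\Sigma_\varphi+\sqrt{\tfrac32}\,\lambda\,\Omega_V,\qquad \Omega_{\rm pf}'=[2(1+q)-3\gamma]\,\Omega_{\rm pf},$$ where $\Omega_V=1-\Sigma_\varphi^2-\Omega_{\rm pf}$ and $q=-1+3\Sigma_\varphi^2+\tfrac32\gamma\,\Omega_{\rm pf}$. In the plane of $(\Sigma_\varphi,\Omega_{\rm pf})$ put $\mathrm K_\pm=(\pm1,0)$, $\mathrm{FL}=(0,1)$, $\mathrm P=(\lambda/\sqrt6,0)$, $\mathrm{dS}=(0,0)$ and, for $\lambda\neq0$, $\mathrm S=\bigl(\sqrt{3/2}\,\gamma/\lambda,\;1-3\gamma/\lambda^2\bigr)$. An interior orbit is the trajectory of a solution, defined for all $N\in\mathbb R$, that stays in the interior $\{\Omega_V>0,\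 \Omega_{\rm pf}>0\}$; it ends at (originates from) a point if the solution tends to that point as $N\to+\infty$ ($N\to-\infty$). Through each point of the interior passes exactly one interior orbit, and: (i) Every interior orbit ends at $\mathrm P$; here $\mathrm P=\mathrm{dS}$ when $\lambda=0$, and $\mathrm P=\mathrm S$ when $\gamma=\lambda^2/3$. (ii) Exactly one interior orbit originates from $\mathrm{FL}$. (iii) Every other interior orbit originates from $\mathrm K_-$ or from $\mathrm K_+$, and for each of $\mathrm K_-$ and $\mathrm K_+$ the interior orbits that originate from it form a 1-parameter set: there is a continuous curve $c:\mathbb R\to\mathbb R^2$ each of whose points lies on such an orbit, and each such orbit contains $c(s)$ for exactly one $s\in\mathbb R$. -/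

import Mathlib

open Filter Topology

noncomputable section

namespace ScalarFluid

/-- States `(Σ_φ, Ω_pf)`. -/
abbrev State : Type := ℝ × ℝ

/-- `Ω_V = 1 - Σ_φ² - Ω_pf`. -/
def OmegaV (p : State) : ℝ := 1 - p.1 ^ 2 - p.2

/-- The deceleration parameter `q = -1 + 3 Σ_φ² + (3/2) γ Ω_pf`. -/
def decel (gam : ℝ) (p : State) : ℝ := -1 + 3 * p.1 ^ 2 + 3 / 2 * gam * p.2

/-- The right-hand side of the planar system for `(Σ_φ, Ω_pf)` in e-fold time `N`. -/
def field (lam gam : ℝ) (p : State) : State :=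
  (-(2 - decel gam p) * p.1 + √(3 / 2) * lam * OmegaV p,
    (2 * (1 + decel gam p) - 3 * gam) * p.2)

/-- The interior state space `Ω_V > 0`, `Ω_pf > 0`. -/
def interiorStates : Set State := {p | 0 < OmegaV p ∧ 0 < p.2}

/-- A solution of the system defined for all e-fold times `N ∈ ℝ`. -/
def IsSolution (lam gam : ℝ) (x : ℝ → State) : Prop :=
  IsIntegralCurve x (fun _ => field lam gam)

/-- An interior orbit: the trajectory of a complete solution that stays in the interior. -/
def IsInteriorOrbit (lam gam : ℝ) (O : Set State) : Prop :=
  O ⊆ interiorStates ∧ ∃ x : ℝ → State, IsSolution lam gam x ∧ Set.range x = O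

/-- The orbit `O` ends at `p`: it is traced out by a solution that tends to `p` as `N → +∞`. -/
def EndsAt (lam gam : ℝ) (O : Set State) (p : State) : Prop :=
  ∃ x : ℝ → State, IsSolution lam gam x ∧ Set.range x = O ∧ Tendsto x atTop (𝓝 p)

/-- The orbit `O` originates from `p`: it is traced out by a solution that tends to `p` as
`N → -∞`. -/
def OriginatesFrom (lam gam : ℝ) (O : Set State) (p : State) : Prop :=
  ∃ x : ℝ → State, IsSolution lam gam x ∧ Set.range x = O ∧ Tendsto x atBot (𝓝 p)

/-- A set of orbits is a 1-parameter set if there is a continuous curve in the state space, with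
parameter in an open interval (here the whole real line), each point of which lies on an orbit of
the set, and which meets every orbit of the set at exactly one parameter value. -/
def IsOneParameterSet (𝒪 : Set (Set State)) : Prop :=
  ∃ c : ℝ → State, Continuous c ∧ (∀ s, ∃ O ∈ 𝒪, c s ∈ O) ∧ ∀ O ∈ 𝒪, ∃! s, c s ∈ O

/-- The kinaton point `K₊`. -/
def Kplus : State := (1, 0)

/-- The kinaton point `K₋`. -/
def Kminus : State := (-1, 0)

/-- The Friedmann–Lemaître point. -/
def FL : State := (0, 1)

/-- The power-law point `P`. -/
def P (lam : ℝ) : State := (lam / √6, 0)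

/-- The de Sitter point. -/
def dS : State := (0, 0)

/-- The scaling point `S` (for `λ ≠ 0`). -/
def S (lam gam : ℝ) : State := (√(3 / 2) * (gam / lam), 1 - 3 * gam / lam ^ 2)

end ScalarFluid

end

/-! With `v = λ / √6`, the function `Z = Ω_V / (1 - v Σ_φ)²` increases strictly along interior
orbits: its logarithmic derivative is a nonnegative multiple of
`3 (Σ_φ - v)² + 3/2 (γ - 2 v²) Ω_pf`. By LaSalle's invariance principle the orbits tend to the
maximum point `P` of `Z` in the future, and `Z`, hence `Ω_V`, tends to `0` in the past.
If `σ Σ_φ > |v|` at some time, with `σ = ± 1`, then `σ Σ_φ` can only grow backwards in time, and the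
limit points in the past lie on orbits in `Ω_V = 0` along which `σ Σ_φ` stays positive: only `K_±`
remains. If `|Σ_φ| ≤ |v|` at all times, only `FL` remains in the same way.

Two orbits from `FL` can be compared at equal values of `Z`. There the difference of their
`Σ_φ`-coordinates solves an equation that contracts near `FL`, since the slope
`dΣ_φ / d(log Z)` has the negative `Σ_φ`-derivative `-(2 - γ) / (2 γ)` at `FL`; as the difference
tends to `0` in the past, it vanishes.

Every interior orbit meets the arc `Z = 1 / 2` exactly once. The points of this open arc on orbits
from `K_-` and from `K_+` form two disjoint nonempty open sets, and at most one point is left, on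
orbits from `FL`. By connectedness that point exists, and it splits the arc into two open arcs. -/

section LipschitzFlow

open Set NNReal

variable {E : Type*} [NormedAddCommGroup E] [NormedSpace ℝ E] {F : E → E} {K M : ℝ≥0}
  {x y : ℝ → E}

theorem eq_of_isIntegralCurve_of_lipschitzWith (hF : LipschitzWith K F)
    (hx : IsIntegralCurve x fun _ ↦ F) (hy : IsIntegralCurve y fun _ ↦ F) {t₀ : ℝ}
    (h : x t₀ = y t₀) : x = y :=
  ODE_solution_unique_univ (s := fun _ ↦ univ) (fun _ ↦ hF.lipschitzOnWith)
    (fun t ↦ ⟨hx t, mem_univ _⟩) (fun t ↦ ⟨hy t, mem_univ _⟩) h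

theorem dist_integralCurve_le_of_nonneg (hF : LipschitzWith K F)
    (hx : IsIntegralCurve x fun _ ↦ F) (hy : IsIntegralCurve y fun _ ↦ F) {t : ℝ} (ht : 0 ≤ t) :
    dist (x t) (y t) ≤ dist (x 0) (y 0) * Real.exp (K * t) := by
  simpa using dist_le_of_trajectories_ODE (v := fun _ ↦ F) (fun _ ↦ hF)
    hx.continuous.continuousOn (fun s _ ↦ (hx s).hasDerivWithinAt)
    hy.continuous.continuousOn (fun s _ ↦ (hy s).hasDerivWithinAt) le_rfl t ⟨ht, le_rfl⟩

theorem isIntegralCurve_comp_neg (hx : IsIntegralCurve x fun _ ↦ F) :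
    IsIntegralCurve (fun t ↦ x (-t)) fun _ ↦ -F := by
  simpa [Function.comp_def, Pi.smul_def] using! hx.comp_mul (-1)

theorem dist_integralCurve_le (hF : LipschitzWith K F)
    (hx : IsIntegralCurve x fun _ ↦ F) (hy : IsIntegralCurve y fun _ ↦ F) (t : ℝ) :
    dist (x t) (y t) ≤ dist (x 0) (y 0) * Real.exp (K * |t|) := by
  rcases le_total 0 t with ht | ht
  · simpa [abs_of_nonneg ht] using dist_integralCurve_le_of_nonneg hF hx hy ht
  · simpa [abs_of_nonpos ht] using dist_integralCurve_le_of_nonneg hF.neg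
      (isIntegralCurve_comp_neg hx) (isIntegralCurve_comp_neg hy) (neg_nonneg.2 ht)

theorem continuous_uncurry_of_isIntegralCurve {x : E → ℝ → E} (hF : LipschitzWith K F)
    (hx : ∀ p, IsIntegralCurve (x p) fun _ ↦ F) (hx0 : ∀ p, x p 0 = p) :
    Continuous (Function.uncurry fun t p ↦ x p t) := by
  rw [continuous_iff_continuousAt]
  rintro ⟨t₀, p₀⟩
  refine tendsto_iff_dist_tendsto_zero.2 (squeeze_zero (fun _ ↦ dist_nonneg)
    (fun z ↦ dist_triangle _ (x p₀ z.1) _) ?_)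
  have h1 : Tendsto (fun z : ℝ × E ↦ dist (x z.2 z.1) (x p₀ z.1)) (𝓝 (t₀, p₀)) (𝓝 0) := by
    refine squeeze_zero (fun _ ↦ dist_nonneg)
      (fun z ↦ dist_integralCurve_le hF (hx z.2) (hx p₀) z.1) ?_
    simp only [hx0]
    exact Continuous.tendsto' (by fun_prop) _ _ (by simp)
  have h2 : Tendsto (fun z : ℝ × E ↦ dist (x p₀ z.1) (x p₀ t₀)) (𝓝 (t₀, p₀)) (𝓝 0) := by
    have := (hx p₀).continuous
    exact Continuous.tendsto' (by fun_prop) _ _ (by simp)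
  simpa [Function.uncurry_def] using h1.add h2

variable [CompleteSpace E]

theorem exists_hasDerivAt_Ioo_of_lipschitzWith_of_bounded (hF : LipschitzWith K F)
    (hM : ∀ p, ‖F p‖ ≤ M) (p : E) (T : ℝ≥0) :
    ∃ x : ℝ → E, x 0 = p ∧ ∀ t ∈ Ioo (-T : ℝ) T, HasDerivAt x (F (x t)) t := by
  have hPL : IsPicardLindelof (fun _ ↦ F) (⟨0, by simp⟩ : Icc (-T : ℝ) T) p (M * T) 0 M K :=
    IsPicardLindelof.of_time_independent (fun x _ ↦ hM x) hF.lipschitzOnWith (by simp)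
  obtain ⟨x, hx0, hx⟩ := hPL.exists_eq_forall_mem_Icc_hasDerivWithinAt₀
  exact ⟨x, hx0, fun t ht ↦
    (hx t (Ioo_subset_Icc_self ht)).hasDerivAt (Icc_mem_nhds ht.1 ht.2)⟩

theorem exists_isIntegralCurve_of_lipschitzWith_of_bounded (hF : LipschitzWith K F)
    (hM : ∀ p, ‖F p‖ ≤ M) (p : E) : ∃ x : ℝ → E, x 0 = p ∧ IsIntegralCurve x fun _ ↦ F := by
  choose x hx0 hx using exists_hasDerivAt_Ioo_of_lipschitzWith_of_bounded hF hM p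
  have agree {T T' : ℝ≥0} {t : ℝ} (hT : |t| < T) (hT' : |t| < T') : x T t = x T' t := by
    have h0 : 0 < min (T : ℝ) T' := (abs_nonneg t).trans_lt (lt_min hT hT')
    refine ODE_solution_unique_of_mem_Ioo (v := fun _ ↦ F) (s := fun _ ↦ univ) (t₀ := 0)
      (a := -min (T : ℝ) T') (b := min (T : ℝ) T') (fun _ _ ↦ hF.lipschitzOnWith)
      ⟨neg_neg_of_pos h0, h0⟩ (fun s hs ↦ ⟨hx T s ?_, mem_univ _⟩)
      (fun s hs ↦ ⟨hx T' s ?_, mem_univ _⟩) (by rw [hx0, hx0]) (abs_lt.1 (lt_min hT hT')) <;>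
    grind
  refine ⟨fun t ↦ x (‖t‖₊ + 1) t, hx0 _, fun t ↦ ?_⟩
  refine (hx (‖t‖₊ + 1) t (abs_lt.1 (by simp))).congr_of_eventuallyEq ?_
  filter_upwards [continuous_abs.continuousAt.eventually_lt_const (lt_add_one |t|)] with s hs
  exact agree (by simp) (by simpa using hs)

theorem exists_flow_of_lipschitzWith_of_bounded (hF : LipschitzWith K F)
    (hM : ∀ p, ‖F p‖ ≤ M) :
    ∃ φ : Flow ℝ E, ∀ p, IsIntegralCurve (fun t ↦ φ t p) fun _ ↦ F := by
  choose x hx0 hx using exists_isIntegralCurve_of_lipschitzWith_of_bounded hF hM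
  refine ⟨⟨fun t p ↦ x p t, continuous_uncurry_of_isIntegralCurve hF hx hx0, fun s t p ↦ ?_, hx0⟩,
    hx⟩
  have hshift : IsIntegralCurve (fun s ↦ x p (s + t)) fun _ ↦ F := (hx p).comp_add t
  exact congrFun (eq_of_isIntegralCurve_of_lipschitzWith hF hshift (hx (x p t)) (t₀ := 0)
    (by simp [hx0])) s

end LipschitzFlow

section Coordinates

variable {𝕜 E F : Type*} [NontriviallyNormedField 𝕜] [NormedAddCommGroup E] [NormedSpace 𝕜 E]
  [NormedAddCommGroup F] [NormedSpace 𝕜 F] {x : 𝕜 → E × F} {x' : E × F} {t : 𝕜}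

theorem hasDerivAt_fst_comp (h : HasDerivAt x x' t) : HasDerivAt (fun s ↦ (x s).1) x'.1 t :=
  (hasFDerivAt_fst (𝕜 := 𝕜) (p := x t)).comp_hasDerivAt t h

theorem hasDerivAt_snd_comp (h : HasDerivAt x x' t) : HasDerivAt (fun s ↦ (x s).2) x'.2 t :=
  (hasFDerivAt_snd (𝕜 := 𝕜) (p := x t)).comp_hasDerivAt t h

end Coordinates

section RealLine

variable {f f' a : ℝ → ℝ} {c C : ℝ}

theorem eq_mul_exp_integral_of_hasDerivAt (ha : Continuous a)
    (hf : ∀ t, HasDerivAt f (a t * f t) t) (t : ℝ) :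
    f t = f 0 * Real.exp (∫ s in 0..t, a s) := by
  set A : ℝ → ℝ := fun t ↦ ∫ s in 0..t, a s
  have hA (t) : HasDerivAt A (a t) t := (ha.integral_hasStrictDerivAt 0 t).hasDerivAt
  have hconst (t) : HasDerivAt (fun s ↦ f s * Real.exp (-A s)) 0 t :=
    ((hf t).mul (hA t).neg.exp).congr_deriv (by ring)
  have h0 : f t * Real.exp (-A t) = f 0 * Real.exp (-A 0) :=
    is_const_of_deriv_eq_zero (fun s ↦ (hconst s).differentiableAt) (fun s ↦ (hconst s).deriv) t 0
  rw [show A 0 = 0 from intervalIntegral.integral_same, neg_zero, Real.exp_zero, mul_one] at h0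
  rw [← h0, mul_assoc, ← Real.exp_add, neg_add_cancel, Real.exp_zero, mul_one]

theorem nonpos_of_mul_le_deriv_of_le (hf : ∀ t, HasDerivAt f (f' t) t) (hc : 0 < c)
    (hf' : ∀ t, c * f t ≤ f' t) (hC : ∀ t, f t ≤ C) (t : ℝ) : f t ≤ 0 := by
  have hmono : Monotone fun s ↦ f s * Real.exp (-(c * s)) := by
    have hd (s : ℝ) : HasDerivAt (fun s ↦ f s * Real.exp (-(c * s)))
        ((f' s - c * f s) * Real.exp (-(c * s))) s :=
      ((hf s).mul ((hasDerivAt_id' s).const_mul c).fun_neg.exp).congr_deriv (by ring)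
    exact monotone_of_hasDerivAt_nonneg hd fun s ↦
      mul_nonneg (sub_nonneg.2 (hf' s)) (Real.exp_pos _).le
  have hlim : Tendsto (fun s ↦ C * Real.exp (-(c * s))) atTop (𝓝 0) := by
    simpa using (Real.tendsto_exp_neg_atTop_nhds_zero.comp
      (tendsto_id.const_mul_atTop hc)).const_mul C
  have hle : f t * Real.exp (-(c * t)) ≤ 0 := by
    refine ge_of_tendsto hlim ?_
    filter_upwards [eventually_ge_atTop t] with s hs
    exact (hmono hs).trans (mul_le_mul_of_nonneg_right (hC s) (Real.exp_pos _).le)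
  exact nonpos_of_mul_nonpos_left hle (Real.exp_pos _)

end RealLine

section InvariancePrinciple

variable {τ α β : Type*} [TopologicalSpace α] [TopologicalSpace β]

theorem eq_of_mapClusterPt_of_tendsto [T2Space β] {l : Filter τ} {u : τ → α} {K : Set α}
    {V : α → β} {ℓ : β} {q : α} (hq : MapClusterPt q l u) (hK : ∀ᶠ t in l, u t ∈ K)
    (hV : ContinuousWithinAt V K q) (hℓ : Tendsto (V ∘ u) l (𝓝 ℓ)) : V q = ℓ := by
  have : (𝓝 q ⊓ map u l).NeBot := hq
  exact tendsto_nhds_unique (hV.mono_left (inf_le_inf_left _ (le_principal_iff.2 hK)))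
    ((tendsto_map'_iff.2 hℓ).mono_left inf_le_right)

variable [TopologicalSpace τ] [AddMonoid τ] [T2Space α] [T2Space β]

theorem tendsto_flow_of_unique_orbit_in_level (φ : Flow τ α) {l : Filter τ} {K : Set α}
    {V : α → β} {ℓ : β} {p p₀ : α} (hl : ∀ s, Tendsto (s + ·) l l) (hK : IsCompact K)
    (hpK : ∀ᶠ t in l, φ t p ∈ K) (hV : ContinuousOn V K)
    (hℓ : Tendsto (fun t ↦ V (φ t p)) l (𝓝 ℓ))
    (huniq : ∀ q, (∀ t, φ t q ∈ K ∧ V (φ t q) = ℓ) → q = p₀) :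
    Tendsto (φ · p) l (𝓝 p₀) := by
  have hcluster {q} (hq : MapClusterPt q l (φ · p)) : q ∈ K ∧ V q = ℓ := by
    have hqK : q ∈ K := hK.isClosed.mem_of_mapClusterPt hq hpK
    exact ⟨hqK, eq_of_mapClusterPt_of_tendsto hq hpK (hV q hqK) hℓ⟩
  refine hK.tendsto_nhds_of_unique_mapClusterPt hpK fun q _ hq ↦ huniq q fun t ↦ hcluster ?_
  have hshift : MapClusterPt (φ t q) l ((φ · p) ∘ (t + ·)) := by
    simpa only [Function.comp_def, ← φ.map_add] using!
      hq.continuousAt_comp (φ.continuous_toFun t).continuousAt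
  exact hshift.of_comp (hl t)

end InvariancePrinciple

section LevelSynchronization

theorem exists_orderIso_comp_eq_of_strictMono {α β γ : Type*} [LinearOrder α] [LinearOrder β]
    [Preorder γ] {f : α → γ} {g : β → γ} (hf : StrictMono f) (hg : StrictMono g)
    (h : Set.range f = Set.range g) : ∃ e : α ≃o β, g ∘ e = f := by
  refine ⟨(hf.orderIso f).trans ((OrderIso.setCongr _ _ h).trans (hg.orderIso g).symm), ?_⟩
  ext a
  exact congrArg Subtype.val
    ((hg.orderIso g).apply_symm_apply (OrderIso.setCongr _ _ h (hf.orderIso f a)))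

theorem range_eq_Ioo_of_strictMono_of_tendsto {α β : Type*} [LinearOrder α] [NoMaxOrder α]
    [NoMinOrder α] [Nonempty α] [TopologicalSpace α] [PreconnectedSpace α] [LinearOrder β]
    [TopologicalSpace β] [OrderTopology β] {f : α → β} {a b : β} (hf : StrictMono f)
    (hfc : Continuous f) (ha : Tendsto f atBot (𝓝 a)) (hb : Tendsto f atTop (𝓝 b)) :
    Set.range f = Set.Ioo a b := by
  refine Set.Subset.antisymm ?_ fun c hc ↦ ?_
  · rintro _ ⟨t, rfl⟩
    obtain ⟨s, hs⟩ := exists_lt t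
    obtain ⟨u, hu⟩ := exists_gt t
    exact ⟨(hf.monotone.le_of_tendsto ha s).trans_lt (hf hs),
      (hf hu).trans_le (hf.monotone.ge_of_tendsto hb u)⟩
  · exact mem_range_of_exists_le_of_exists_ge hfc
      ((ha.eventually_le_const hc.1).exists) ((hb.eventually_const_le hc.2).exists)

theorem hasDerivAt_div_of_comp_eq {𝕜 : Type*} [NontriviallyNormedField 𝕜] {f g e : 𝕜 → 𝕜}
    {f' g' x : 𝕜} (he : ContinuousAt e x) (hg : HasDerivAt g g' (e x)) (hf : HasDerivAt f f' x)
    (hg' : g' ≠ 0) (hcomp : g ∘ e =ᶠ[𝓝 x] f) : HasDerivAt e (f' / g') x := by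
  have hinv : Function.LeftInverse (ContinuousLinearMap.toSpanSingleton 𝕜 g'⁻¹)
      (ContinuousLinearMap.toSpanSingleton 𝕜 g') := fun y ↦ by simp [hg']
  simpa [div_eq_mul_inv] using
    (hg.hasFDerivAt.of_comp_of_leftInverse he hf.hasFDerivAt hcomp hinv).hasDerivAt

theorem eventually_eq_zero_of_mul_deriv_nonpos {f f' : ℝ → ℝ}
    (hf : ∀ᶠ t in atBot, HasDerivAt f (f' t) t) (hf' : ∀ᶠ t in atBot, f t * f' t ≤ 0)
    (hlim : Tendsto f atBot (𝓝 0)) :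
    ∀ᶠ t in atBot, f t = 0 := by
  obtain ⟨T, hT⟩ := eventually_atBot.1 (hf.and hf')
  have hd (t : ℝ) (ht : t ≤ T) : HasDerivAt (fun t ↦ f t ^ 2) (2 * (f t * f' t)) t :=
    ((hT t ht).1.fun_pow 2).congr_deriv (by push_cast; ring)
  have hanti : AntitoneOn (fun t ↦ f t ^ 2) (Set.Iic T) := by
    refine antitoneOn_of_deriv_nonpos (convex_Iic T)
      (fun t ht ↦ (hd t ht).continuousAt.continuousWithinAt)
      (fun t ht ↦
        (hd t (interior_subset (s := Set.Iic T) ht)).differentiableAt.differentiableWithinAt)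
      fun t ht ↦ ?_
    have htT : t ≤ T := interior_subset (s := Set.Iic T) ht
    rw [(hd t htT).deriv]
    linarith [(hT t htT).2]
  filter_upwards [eventually_le_atBot T] with t ht
  have h0 : f t ^ 2 ≤ 0 := by
    refine ge_of_tendsto (by simpa using hlim.pow 2) ?_
    filter_upwards [eventually_le_atBot t] with s hs
    exact hanti (hs.trans ht) ht hs
  exact pow_eq_zero_iff two_ne_zero |>.1 (h0.antisymm (sq_nonneg _))

theorem eventually_sub_mul_sub_nonpos_of_hasStrictFDerivAt {E : Type*} [NormedAddCommGroup E]
    [NormedSpace ℝ E] {G : ℝ × E → ℝ} {G' : ℝ × E →L[ℝ] ℝ} {x : ℝ × E}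
    (hG : HasStrictFDerivAt G G' x) (hneg : G' (1, 0) < 0) :
    ∀ᶠ z in 𝓝 (x, x), z.1.2 = z.2.2 → (z.1.1 - z.2.1) * (G z.1 - G z.2) ≤ 0 := by
  filter_upwards [hG.isLittleO.def (neg_pos.2 hneg)] with z hz hz2
  set d := z.1.1 - z.2.1
  have hd : z.1 - z.2 = d • ((1, 0) : ℝ × E) := by ext <;> simp [d, hz2]
  rw [hd, map_smul, norm_smul, Prod.norm_mk, norm_one, norm_zero, max_eq_left zero_le_one, mul_one,
    smul_eq_mul, Real.norm_eq_abs, Real.norm_eq_abs] at hz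
  calc d * (G z.1 - G z.2)
      = d * (G z.1 - G z.2 - d * G' (1, 0)) + d ^ 2 * G' (1, 0) := by ring
    _ ≤ |d| * (-G' (1, 0) * |d|) + d ^ 2 * G' (1, 0) := by
      grw [le_abs_self (d * _), abs_mul, hz]
    _ = 0 := by rw [← sq_abs d]; ring

end LevelSynchronization

section IntervalSplitting

open Set

theorem exists_Ioo_split {a b : ℝ} {A B C : Set ℝ} (hABC : A ∪ B ∪ C = Ioo a b)
    (hA : IsOpen A) (hB : IsOpen B) (hA' : A.Nonempty) (hB' : B.Nonempty) (hAB : Disjoint A B)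
    (hAC : Disjoint A C) (hBC : Disjoint B C) (hC : C.Subsingleton) :
    ∃ c ∈ Ioo a b, C = {c} ∧ (A = Ioo a c ∧ B = Ioo c b ∨ A = Ioo c b ∧ B = Ioo a c) := by
  have hside {U : Set ℝ} (hU : IsPreconnected U) (hUAB : U ⊆ A ∪ B) : U ⊆ A ∨ U ⊆ B :=
    hU.subset_or_subset hA hB hAB hUAB
  obtain ⟨c, hc⟩ : C.Nonempty := by
    by_contra! hne
    rw [hne, union_empty] at hABC
    rcases hside isPreconnected_Ioo hABC.ge with h | h
    · exact hB'.ne_empty (hAB.symm.eq_bot_of_le ((hABC ▸ subset_union_right).trans h))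
    · exact hA'.ne_empty (hAB.eq_bot_of_le ((hABC ▸ subset_union_left).trans h))
  obtain rfl : C = {c} := hC.eq_singleton_of_mem hc
  have hmem (u : ℝ) : u ∈ Ioo a b ↔ u ∈ A ∨ u ∈ B ∨ u = c := by
    rw [← hABC, mem_union, mem_union, or_assoc, mem_singleton_iff]
  have hcA : c ∉ A := hAC.notMem_of_mem_right rfl
  have hcB : c ∉ B := hBC.notMem_of_mem_right rfl
  have hAB' (u) (hu : u ∈ A) : u ∉ B := hAB.notMem_of_mem_left hu
  have hcab : c ∈ Ioo a b := by simp [hmem]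
  have hleft : Ioo a c ⊆ A ∪ B := by grind
  have hright : Ioo c b ⊆ A ∪ B := by grind
  refine ⟨c, hcab, rfl, ?_⟩
  rcases hside isPreconnected_Ioo hleft with hl | hl <;>
    rcases hside isPreconnected_Ioo hright with hr | hr
  · obtain ⟨u, hu⟩ := hB'
    grind
  · left
    constructor <;> ext u <;> grind
  · right
    constructor <;> ext u <;> grind
  · obtain ⟨u, hu⟩ := hA'
    grind

theorem exists_continuous_injective_range_eq_Ioo {a b : ℝ} (hab : a < b) :
    ∃ e : ℝ → ℝ, Continuous e ∧ Function.Injective e ∧ range e = Ioo a b := by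
  let e := OpenPartialHomeomorph.univBall ((a + b) / 2) ((b - a) / 2)
  have hsource : e.source = univ := OpenPartialHomeomorph.univBall_source _ _
  refine ⟨e, OpenPartialHomeomorph.continuous_univBall _ _, ?_, ?_⟩
  · rw [← injOn_univ, ← hsource]
    exact e.injOn
  · rw [← image_univ, ← hsource, e.image_source_eq_target, Real.Ioo_eq_ball]
    exact OpenPartialHomeomorph.univBall_target _ (by linarith)

end IntervalSplitting

namespace ScalarFluid

open Set

section Flow

variable {lam gam : ℝ} {p : State} {t : ℝ}

/-- The `Σ_φ`-coordinate of the power-law point `P`. -/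
noncomputable def sigmaP (lam : ℝ) : ℝ := lam / √6

theorem sigmaP_sq (lam : ℝ) : sigmaP lam ^ 2 = lam ^ 2 / 6 := by
  rw [sigmaP, div_pow, Real.sq_sqrt (by norm_num)]

theorem sqrt_mul_eq_three_mul_sigmaP (lam : ℝ) : √(3 / 2) * lam = 3 * sigmaP lam := by
  have h6 : √(3 / 2) = 3 / √6 := by
    rw [eq_div_iff (by positivity), ← Real.sqrt_mul (by norm_num),
      show (3 / 2 * 6 : ℝ) = 3 ^ 2 by norm_num, Real.sqrt_sq (by norm_num)]
  rw [h6, sigmaP]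
  ring

theorem field_fst (lam gam : ℝ) (p : State) : (field lam gam p).1 =
    -(3 * OmegaV p + 3 / 2 * (2 - gam) * p.2) * p.1 + 3 * sigmaP lam * OmegaV p := by
  rw [field, sqrt_mul_eq_three_mul_sigmaP]
  simp only [decel, OmegaV]
  ring

theorem field_snd (lam gam : ℝ) (p : State) : (field lam gam p).2 =
    (6 * p.1 ^ 2 - 3 * gam * (1 - p.2)) * p.2 := by
  simp only [field, decel]
  ring

theorem contDiff_field (lam gam : ℝ) : ContDiff ℝ 1 (field lam gam) := by
  unfold field decel OmegaV
  fun_prop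

theorem continuous_OmegaV : Continuous OmegaV := by
  unfold OmegaV
  fun_prop

theorem hasDerivAt_OmegaV {x : ℝ → State} {c : ℝ}
    (h : HasDerivAt x (c • field lam gam (x t)) t) :
    HasDerivAt (fun s ↦ OmegaV (x s))
      (c * (6 * (x t).1 ^ 2 + 3 * gam * (x t).2 - 6 * sigmaP lam * (x t).1) * OmegaV (x t)) t := by
  have hfst : HasDerivAt (fun s ↦ (x s).1) (c * (field lam gam (x t)).1) t :=
    hasDerivAt_fst_comp h
  have hsnd : HasDerivAt (fun s ↦ (x s).2) (c * (field lam gam (x t)).2) t :=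
    hasDerivAt_snd_comp h
  refine (((hasDerivAt_const t (1 : ℝ)).fun_sub (hfst.fun_pow 2)).fun_sub hsnd).congr_deriv ?_
  rw [field_fst, field_snd, OmegaV]
  push_cast
  ring

/-- The state space with its boundary, `Ω_V ≥ 0` and `Ω_pf ≥ 0`: a compact set, invariant under
the flow. -/
def closedStates : Set State := {p | 0 ≤ OmegaV p ∧ 0 ≤ p.2}

theorem interiorStates_subset_closedStates : interiorStates ⊆ closedStates :=
  fun _ hp ↦ ⟨hp.1.le, hp.2.le⟩

theorem isOpen_interiorStates : IsOpen interiorStates :=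
  (isOpen_lt continuous_const continuous_OmegaV).inter (isOpen_lt continuous_const continuous_snd)

theorem sq_fst_add_snd_le_one (hp : p ∈ closedStates) : p.1 ^ 2 + p.2 ≤ 1 := by
  have := hp.1
  unfold OmegaV at this
  linarith

theorem abs_fst_le_one (hp : p ∈ closedStates) : |p.1| ≤ 1 :=
  (sq_le_one_iff_abs_le_one _).1 (by linarith [sq_fst_add_snd_le_one hp, hp.2])

theorem norm_le_one (hp : p ∈ closedStates) : ‖p‖ ≤ 1 := by
  refine norm_prod_le_iff.2 ⟨abs_fst_le_one hp, ?_⟩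
  rw [Real.norm_of_nonneg hp.2]
  linarith [sq_fst_add_snd_le_one hp, sq_nonneg p.1]

theorem isCompact_closedStates : IsCompact closedStates := by
  refine (isCompact_closedBall (0 : State) 1).of_isClosed_subset ?_ fun p hp ↦ ?_
  · exact (isClosed_le continuous_const continuous_OmegaV).inter
      (isClosed_le continuous_const continuous_snd)
  · exact mem_closedBall_zero_iff.2 (norm_le_one hp)

/-- A smooth function with compact support that equals `1` on the closed state space. -/
noncomputable def cutoff : ContDiffBump (0 : State) := ⟨1, 2, one_pos, one_lt_two⟩

theorem cutoff_eq_one (hp : p ∈ closedStates) : cutoff p = 1 :=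
  cutoff.one_of_mem_closedBall (mem_closedBall_zero_iff.2 (norm_le_one hp))

/-- The field, cut off outside the closed state space in order to have complete solutions. -/
noncomputable def cutoffField (lam gam : ℝ) (p : State) : State := cutoff p • field lam gam p

theorem cutoffField_eq_field (hp : p ∈ closedStates) :
    cutoffField lam gam p = field lam gam p := by
  rw [cutoffField, cutoff_eq_one hp, one_smul]

theorem contDiff_cutoffField (lam gam : ℝ) : ContDiff ℝ 1 (cutoffField lam gam) :=
  cutoff.contDiff.smul (contDiff_field lam gam)

theorem hasCompactSupport_cutoffField (lam gam : ℝ) : HasCompactSupport (cutoffField lam gam) :=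
  cutoff.hasCompactSupport.smul_right

theorem exists_lipschitzWith_cutoffField (lam gam : ℝ) :
    ∃ K, LipschitzWith K (cutoffField lam gam) :=
  (contDiff_cutoffField lam gam).lipschitzWith_of_hasCompactSupport
    (hasCompactSupport_cutoffField lam gam) one_ne_zero

theorem exists_flow_cutoffField (lam gam : ℝ) :
    ∃ φ : Flow ℝ State, ∀ p, IsIntegralCurve (fun t ↦ φ t p) fun _ ↦ cutoffField lam gam := by
  obtain ⟨K, hK⟩ := exists_lipschitzWith_cutoffField lam gam
  obtain ⟨M, hM⟩ := (hasCompactSupport_cutoffField lam gam).exists_bound_of_continuous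
    (contDiff_cutoffField lam gam).continuous
  exact exists_flow_of_lipschitzWith_of_bounded hK fun p ↦ (hM p).trans (Real.le_coe_toNNReal M)

/-- The flow of the system: a flow on the whole plane that follows `field` on the closed state
space, the values elsewhere being an artefact of `cutoffField`. -/
noncomputable def flow (lam gam : ℝ) : Flow ℝ State := (exists_flow_cutoffField lam gam).choose

theorem isIntegralCurve_flow (lam gam : ℝ) (p : State) :
    IsIntegralCurve (fun t ↦ flow lam gam t p) fun _ ↦ cutoffField lam gam :=
  (exists_flow_cutoffField lam gam).choose_spec p

theorem continuous_flow (lam gam : ℝ) (p : State) : Continuous fun t ↦ flow lam gam t p :=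
  (isIntegralCurve_flow lam gam p).continuous

theorem exists_pos_mul_OmegaV_flow (lam gam : ℝ) (p : State) (t : ℝ) :
    ∃ c > 0, OmegaV (flow lam gam t p) = OmegaV p * c := by
  have := continuous_flow lam gam p
  have hlin := eq_mul_exp_integral_of_hasDerivAt (f := fun t ↦ OmegaV (flow lam gam t p))
    (by have := cutoff.continuous; fun_prop)
    (fun t ↦ hasDerivAt_OmegaV (isIntegralCurve_flow lam gam p t)) t
  exact ⟨_, Real.exp_pos _, by simpa only [Flow.map_zero_apply] using hlin⟩

theorem exists_pos_mul_snd_flow (lam gam : ℝ) (p : State) (t : ℝ) :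
    ∃ c > 0, (flow lam gam t p).2 = p.2 * c := by
  have := continuous_flow lam gam p
  have hlin := eq_mul_exp_integral_of_hasDerivAt (f := fun t ↦ (flow lam gam t p).2)
    (a := fun t ↦ cutoff (flow lam gam t p) *
      (6 * (flow lam gam t p).1 ^ 2 - 3 * gam * (1 - (flow lam gam t p).2)))
    (by have := cutoff.continuous; fun_prop)
    (fun t ↦ by
      rw [mul_assoc, ← field_snd]
      exact hasDerivAt_snd_comp (isIntegralCurve_flow lam gam p t)) t
  exact ⟨_, Real.exp_pos _, by simpa only [Flow.map_zero_apply] using hlin⟩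

theorem flow_mem_closedStates_iff : flow lam gam t p ∈ closedStates ↔ p ∈ closedStates := by
  obtain ⟨c, hc, hΩ⟩ := exists_pos_mul_OmegaV_flow lam gam p t
  obtain ⟨d, hd, hs⟩ := exists_pos_mul_snd_flow lam gam p t
  simp only [closedStates, mem_ofPred_eq, hΩ, hs, mul_nonneg_iff_of_pos_right, hc, hd]

theorem flow_mem_interiorStates_iff : flow lam gam t p ∈ interiorStates ↔ p ∈ interiorStates := by
  obtain ⟨c, hc, hΩ⟩ := exists_pos_mul_OmegaV_flow lam gam p t
  obtain ⟨d, hd, hs⟩ := exists_pos_mul_snd_flow lam gam p t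
  simp only [interiorStates, mem_ofPred_eq, hΩ, hs, mul_pos_iff_of_pos_right, hc, hd]

theorem hasDerivAt_flow (hp : p ∈ closedStates) (t : ℝ) :
    HasDerivAt (fun t ↦ flow lam gam t p) (field lam gam (flow lam gam t p)) t := by
  rw [← cutoffField_eq_field (flow_mem_closedStates_iff.2 hp)]
  exact isIntegralCurve_flow lam gam p t

theorem hasDerivAt_flow_fst (hp : p ∈ closedStates) (t : ℝ) :
    HasDerivAt (fun t ↦ (flow lam gam t p).1) (field lam gam (flow lam gam t p)).1 t :=
  hasDerivAt_fst_comp (hasDerivAt_flow hp t)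

theorem hasDerivAt_flow_snd (hp : p ∈ closedStates) (t : ℝ) :
    HasDerivAt (fun t ↦ (flow lam gam t p).2) (field lam gam (flow lam gam t p)).2 t :=
  hasDerivAt_snd_comp (hasDerivAt_flow hp t)

theorem hasDerivAt_OmegaV_flow (hp : p ∈ closedStates) (t : ℝ) :
    HasDerivAt (fun t ↦ OmegaV (flow lam gam t p))
      ((6 * (flow lam gam t p).1 ^ 2 + 3 * gam * (flow lam gam t p).2
        - 6 * sigmaP lam * (flow lam gam t p).1) * OmegaV (flow lam gam t p)) t := by
  simpa only [one_mul] using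
    hasDerivAt_OmegaV ((hasDerivAt_flow hp t).congr_deriv (one_smul ℝ _).symm)

theorem eq_flow_of_isSolution {x : ℝ → State} (hx : IsSolution lam gam x)
    (hmem : ∀ t, x t ∈ interiorStates) : x = fun t ↦ flow lam gam t (x 0) := by
  obtain ⟨K, hK⟩ := exists_lipschitzWith_cutoffField lam gam
  refine eq_of_isIntegralCurve_of_lipschitzWith hK (fun t ↦ ?_)
    (isIntegralCurve_flow lam gam (x 0)) (t₀ := 0) ((flow lam gam).map_zero_apply _).symm
  exact (hx t).congr_deriv
    (cutoffField_eq_field (interiorStates_subset_closedStates (hmem t))).symm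

theorem isInteriorOrbit_iff {O : Set State} :
    IsInteriorOrbit lam gam O ↔ ∃ p ∈ interiorStates, (flow lam gam).orbit p = O := by
  constructor
  · rintro ⟨hO, x, hx, rfl⟩
    refine ⟨x 0, hO (mem_range_self 0), ?_⟩
    rw [Flow.orbit_eq_range, ← eq_flow_of_isSolution hx fun t ↦ hO (mem_range_self t)]
  · rintro ⟨p, hp, rfl⟩
    refine ⟨?_, _, hasDerivAt_flow (interiorStates_subset_closedStates hp), rfl⟩
    rintro _ ⟨t, rfl⟩
    exact flow_mem_interiorStates_iff.2 hp

theorem endsAt_orbit_of_tendsto {κ : State} (hp : p ∈ closedStates)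
    (h : Tendsto (flow lam gam · p) atTop (𝓝 κ)) : EndsAt lam gam ((flow lam gam).orbit p) κ :=
  ⟨_, hasDerivAt_flow hp, rfl, h⟩

theorem tendsto_flow_apply_atBot_iff {κ : State} (s : ℝ) :
    Tendsto (flow lam gam · (flow lam gam s p)) atBot (𝓝 κ) ↔
      Tendsto (flow lam gam · p) atBot (𝓝 κ) := by
  conv_rhs => rw [← (OrderIso.addRight s).map_atBot, tendsto_map'_iff]
  simp only [Function.comp_def, OrderIso.addRight_apply, Flow.map_add]

theorem originatesFrom_orbit_iff {κ : State} (hp : p ∈ interiorStates) :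
    OriginatesFrom lam gam ((flow lam gam).orbit p) κ ↔
      Tendsto (flow lam gam · p) atBot (𝓝 κ) := by
  refine ⟨fun ⟨x, hx, hxp, hκ⟩ ↦ ?_,
    fun h ↦ ⟨_, hasDerivAt_flow (interiorStates_subset_closedStates hp), rfl, h⟩⟩
  have hmem (t) : ∃ s, flow lam gam s p = x t := hxp.le (mem_range_self t)
  have hxflow := eq_flow_of_isSolution hx fun t ↦ by
    obtain ⟨s, hs⟩ := hmem t
    exact hs ▸ flow_mem_interiorStates_iff.2 hp
  obtain ⟨s, hs⟩ := hmem 0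
  rwa [hxflow, ← hs, tendsto_flow_apply_atBot_iff] at hκ

theorem existsUnique_isInteriorOrbit_mem (lam gam : ℝ) (hp : p ∈ interiorStates) :
    ∃! O, IsInteriorOrbit lam gam O ∧ p ∈ O := by
  refine ⟨(flow lam gam).orbit p, ⟨isInteriorOrbit_iff.2 ⟨p, hp, rfl⟩, Flow.mem_orbit_self ..⟩, ?_⟩
  rintro O ⟨hO, hpO⟩
  obtain ⟨q, -, rfl⟩ := isInteriorOrbit_iff.1 hO
  exact ((flow lam gam).toAddAction.orbit_eq_iff.2 hpO).symm

end Flow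

section Lyapunov

variable {lam gam : ℝ} {p : State} {t : ℝ}

/-- The parameter range `0 < γ < 2`, `λ² / 3 ≤ γ`. -/
structure Admissible (lam gam : ℝ) : Prop where
  gam_pos : 0 < gam
  gam_lt_two : gam < 2
  two_mul_sigmaP_sq_le : 2 * sigmaP lam ^ 2 ≤ gam

theorem Admissible.abs_sigmaP_lt_one (h : Admissible lam gam) : |sigmaP lam| < 1 :=
  (sq_lt_one_iff_abs_lt_one _).1 (by linarith [h.two_mul_sigmaP_sq_le, h.gam_lt_two])

/-- The function `Ω_V / (1 - λ Σ_φ / √6)²`, which increases along the flow. -/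
noncomputable def lyapunov (lam : ℝ) (p : State) : ℝ := OmegaV p / (1 - sigmaP lam * p.1) ^ 2

/-- The logarithmic growth rate of `lyapunov` along the flow. -/
noncomputable def lyapunovRate (lam gam : ℝ) (p : State) : ℝ :=
  2 / (1 - sigmaP lam * p.1) *
    (3 * (p.1 - sigmaP lam) ^ 2 + 3 / 2 * (gam - 2 * sigmaP lam ^ 2) * p.2)

theorem abs_sigmaP_mul_fst_lt_one (hv : |sigmaP lam| < 1) (hp : p ∈ closedStates) :
    |sigmaP lam * p.1| < 1 := by
  rw [abs_mul]
  exact mul_lt_one_of_nonneg_of_lt_one_left (abs_nonneg _) hv (abs_fst_le_one hp)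

theorem one_sub_sigmaP_mul_fst_pos (hv : |sigmaP lam| < 1) (hp : p ∈ closedStates) :
    0 < 1 - sigmaP lam * p.1 := by
  linarith [(abs_lt.1 (abs_sigmaP_mul_fst_lt_one hv hp)).2]

theorem lyapunov_mul_sq (hv : |sigmaP lam| < 1) (hp : p ∈ closedStates) :
    lyapunov lam p * (1 - sigmaP lam * p.1) ^ 2 = OmegaV p :=
  div_mul_cancel₀ _ (pow_ne_zero 2 (one_sub_sigmaP_mul_fst_pos hv hp).ne')

theorem continuousOn_lyapunov (hv : |sigmaP lam| < 1) :
    ContinuousOn (lyapunov lam) closedStates :=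
  continuous_OmegaV.continuousOn.div (by fun_prop) fun _ hp ↦
    pow_ne_zero 2 (one_sub_sigmaP_mul_fst_pos hv hp).ne'

theorem lyapunov_pos (hv : |sigmaP lam| < 1) (hp : p ∈ interiorStates) : 0 < lyapunov lam p :=
  div_pos hp.1
    (pow_pos (one_sub_sigmaP_mul_fst_pos hv (interiorStates_subset_closedStates hp)) 2)

theorem lyapunov_le (hv : |sigmaP lam| < 1) (hp : p ∈ closedStates) :
    lyapunov lam p ≤ 1 / (1 - sigmaP lam ^ 2) := by
  have h1 := one_sub_sigmaP_mul_fst_pos hv hp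
  have h2 := (sq_lt_one_iff_abs_lt_one _).2 hv
  rw [lyapunov, div_le_div_iff₀ (by positivity) (by linarith)]
  have h3 : OmegaV p ≤ 1 - p.1 ^ 2 := by
    unfold OmegaV
    linarith [hp.2]
  nlinarith [sq_nonneg (p.1 - sigmaP lam)]

theorem P_mem_closedStates (hv : |sigmaP lam| < 1) : P lam ∈ closedStates := by
  refine ⟨?_, le_rfl⟩
  change 0 ≤ 1 - sigmaP lam ^ 2 - 0
  linarith [(sq_lt_one_iff_abs_lt_one _).2 hv]

theorem lyapunov_P (hv : |sigmaP lam| < 1) : lyapunov lam (P lam) = 1 / (1 - sigmaP lam ^ 2) := by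
  have h1 : 1 - sigmaP lam ^ 2 ≠ 0 := by linarith [(sq_lt_one_iff_abs_lt_one _).2 hv]
  change (1 - sigmaP lam ^ 2 - 0) / (1 - sigmaP lam * sigmaP lam) ^ 2 = _
  rw [← pow_two, sub_zero]
  field_simp

theorem hasDerivAt_lyapunov_flow (hv : |sigmaP lam| < 1) (hp : p ∈ closedStates) (t : ℝ) :
    HasDerivAt (fun t ↦ lyapunov lam (flow lam gam t p))
      (lyapunov lam (flow lam gam t p) * lyapunovRate lam gam (flow lam gam t p)) t := by
  have hmem : flow lam gam t p ∈ closedStates := flow_mem_closedStates_iff.2 hp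
  have h1 := (one_sub_sigmaP_mul_fst_pos hv hmem).ne'
  have hden := ((hasDerivAt_const t (1 : ℝ)).fun_sub
    ((hasDerivAt_flow_fst (lam := lam) (gam := gam) hp t).const_mul (sigmaP lam))).fun_pow 2
  refine ((hasDerivAt_OmegaV_flow hp t).fun_div hden (pow_ne_zero 2 h1)).congr_deriv ?_
  rw [lyapunov, lyapunovRate, field_fst, div_mul_eq_mul_div 2, div_mul_div_comm,
    div_eq_div_iff (pow_ne_zero 2 (pow_ne_zero 2 h1)) (mul_ne_zero (pow_ne_zero 2 h1) h1)]
  unfold OmegaV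
  push_cast
  ring

theorem lyapunovRate_nonneg (h : Admissible lam gam) (hp : p ∈ closedStates) :
    0 ≤ lyapunovRate lam gam p := by
  have h1 := one_sub_sigmaP_mul_fst_pos h.abs_sigmaP_lt_one hp
  have h2 := mul_nonneg (sub_nonneg.2 h.two_mul_sigmaP_sq_le) hp.2
  refine mul_nonneg (by positivity) ?_
  nlinarith [sq_nonneg (p.1 - sigmaP lam)]

theorem fst_eq_and_mul_snd_eq_zero_of_lyapunovRate_eq_zero (h : Admissible lam gam)
    (hp : p ∈ closedStates) (h0 : lyapunovRate lam gam p = 0) :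
    p.1 = sigmaP lam ∧ (gam - 2 * sigmaP lam ^ 2) * p.2 = 0 := by
  have h1 := one_sub_sigmaP_mul_fst_pos h.abs_sigmaP_lt_one hp
  have h2 := mul_nonneg (sub_nonneg.2 h.two_mul_sigmaP_sq_le) hp.2
  have h3 := sq_nonneg (p.1 - sigmaP lam)
  have h4 := (mul_eq_zero.1 h0).resolve_left (by positivity)
  exact ⟨sub_eq_zero.1 (pow_eq_zero_iff two_ne_zero |>.1 (by linarith)), by linarith⟩

theorem flow_eq_P_of_lyapunov_eventually_const (h : Admissible lam gam) (hp : p ∈ closedStates)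
    {z : ℝ} (hz : z ≠ 0) (hconst : ∀ᶠ t in 𝓝 t, lyapunov lam (flow lam gam t p) = z) :
    flow lam gam t p = P lam := by
  have hv := h.abs_sigmaP_lt_one
  have hmem (t) : flow lam gam t p ∈ closedStates := flow_mem_closedStates_iff.2 hp
  have hrate : ∀ᶠ t in 𝓝 t, (flow lam gam t p).1 = sigmaP lam ∧
      (gam - 2 * sigmaP lam ^ 2) * (flow lam gam t p).2 = 0 := by
    filter_upwards [hconst.eventually_nhds] with s hs
    have hderiv := (hasDerivAt_lyapunov_flow hv hp s).unique
      ((hasDerivAt_const s z).congr_of_eventuallyEq hs)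
    rw [hs.self_of_nhds] at hderiv
    exact fst_eq_and_mul_snd_eq_zero_of_lyapunovRate_eq_zero h (hmem s)
      ((mul_eq_zero.1 hderiv).resolve_left hz)
  obtain ⟨hfst, hsnd⟩ := hrate.self_of_nhds
  have hstat := (hasDerivAt_flow_fst hp t).unique
    ((hasDerivAt_const t (sigmaP lam)).congr_of_eventuallyEq (hrate.mono fun _ hs ↦ hs.1))
  have hmul : (2 - gam) * (sigmaP lam * (flow lam gam t p).2) = 0 := by
    rw [field_fst, hfst] at hstat
    linear_combination -(2 / 3) * hstat
  refine Prod.ext hfst ?_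
  rcases mul_eq_zero.1 (mul_eq_zero.1 hmul |>.resolve_left (by linarith [h.gam_lt_two]))
    with hv0 | hsnd0
  · rw [hv0] at hsnd
    exact (mul_eq_zero.1 hsnd).resolve_left (by linarith [h.gam_pos])
  · exact hsnd0

theorem tendsto_flow_P_of_tendsto_lyapunov (h : Admissible lam gam) (hp : p ∈ closedStates)
    {l : Filter ℝ} [l.NeBot] (hl : ∀ s, Tendsto (s + ·) l l) {ℓ : ℝ} (hℓ : ℓ ≠ 0)
    (hlim : Tendsto (fun t ↦ lyapunov lam (flow lam gam t p)) l (𝓝 ℓ)) :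
    Tendsto (flow lam gam · p) l (𝓝 (P lam)) := by
  refine tendsto_flow_of_unique_orbit_in_level _ hl isCompact_closedStates
    (.of_forall fun t ↦ flow_mem_closedStates_iff.2 hp)
    (continuousOn_lyapunov h.abs_sigmaP_lt_one) hlim fun q hq ↦ ?_
  rw [← (flow lam gam).map_zero_apply q]
  exact flow_eq_P_of_lyapunov_eventually_const h
    (flow_mem_closedStates_iff.1 (hq 0).1) hℓ (.of_forall fun t ↦ (hq t).2)

theorem strictMono_lyapunov_flow (h : Admissible lam gam) (hp : p ∈ interiorStates) :
    StrictMono fun t ↦ lyapunov lam (flow lam gam t p) := by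
  have hv := h.abs_sigmaP_lt_one
  have hpc := interiorStates_subset_closedStates hp
  have hmono : Monotone fun t ↦ lyapunov lam (flow lam gam t p) :=
    monotone_of_hasDerivAt_nonneg (hasDerivAt_lyapunov_flow hv hpc) fun t ↦
      mul_nonneg (lyapunov_pos hv (flow_mem_interiorStates_iff.2 hp)).le
        (lyapunovRate_nonneg h (flow_mem_closedStates_iff.2 hpc))
  intro a b hab
  refine (hmono hab.le).lt_of_ne fun heq ↦ ?_
  obtain ⟨t, ht⟩ := nonempty_Ioo.2 hab
  have hconst : ∀ᶠ s in 𝓝 t, lyapunov lam (flow lam gam s p) = lyapunov lam (flow lam gam a p) := by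
    filter_upwards [isOpen_Ioo.mem_nhds ht] with s hs
    exact le_antisymm ((hmono hs.2.le).trans heq.ge) (hmono hs.1.le)
  have hP := flow_eq_P_of_lyapunov_eventually_const h hpc
    (lyapunov_pos hv (flow_mem_interiorStates_iff.2 hp)).ne' hconst
  exact (flow_mem_interiorStates_iff.2 hp : flow lam gam t p ∈ _).2.ne' (congrArg Prod.snd hP)

theorem tendsto_lyapunov_P (hv : |sigmaP lam| < 1) (hp : p ∈ closedStates) {l : Filter ℝ}
    (hP : Tendsto (flow lam gam · p) l (𝓝 (P lam))) :
    Tendsto (fun t ↦ lyapunov lam (flow lam gam t p)) l (𝓝 (1 / (1 - sigmaP lam ^ 2))) := by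
  rw [← lyapunov_P hv]
  exact (continuousOn_lyapunov hv _ (P_mem_closedStates hv)).tendsto.comp
    (tendsto_nhdsWithin_iff.2 ⟨hP, .of_forall fun t ↦ flow_mem_closedStates_iff.2 hp⟩)

theorem tendsto_flow_atTop_P (h : Admissible lam gam) (hp : p ∈ interiorStates) :
    Tendsto (flow lam gam · p) atTop (𝓝 (P lam)) := by
  have hv := h.abs_sigmaP_lt_one
  have hpc := interiorStates_subset_closedStates hp
  have hbdd : BddAbove (range fun t ↦ lyapunov lam (flow lam gam t p)) :=
    ⟨_, forall_mem_range.2 fun t ↦ lyapunov_le hv (flow_mem_closedStates_iff.2 hpc)⟩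
  refine tendsto_flow_P_of_tendsto_lyapunov h hpc
    (fun s ↦ tendsto_atTop_add_const_left _ s tendsto_id) ?_
    (tendsto_atTop_ciSup (strictMono_lyapunov_flow h hp).monotone hbdd)
  exact ((lyapunov_pos hv (flow_mem_interiorStates_iff.2 hp)).trans_le (le_ciSup hbdd 0)).ne'

theorem tendsto_lyapunov_flow_atTop (h : Admissible lam gam) (hp : p ∈ interiorStates) :
    Tendsto (fun t ↦ lyapunov lam (flow lam gam t p)) atTop (𝓝 (1 / (1 - sigmaP lam ^ 2))) :=
  tendsto_lyapunov_P h.abs_sigmaP_lt_one (interiorStates_subset_closedStates hp)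
    (tendsto_flow_atTop_P h hp)

theorem tendsto_lyapunov_flow_atBot (h : Admissible lam gam) (hp : p ∈ interiorStates) :
    Tendsto (fun t ↦ lyapunov lam (flow lam gam t p)) atBot (𝓝 0) := by
  have hv := h.abs_sigmaP_lt_one
  have hpc := interiorStates_subset_closedStates hp
  have hmono := strictMono_lyapunov_flow h hp
  have hbdd : BddBelow (range fun t ↦ lyapunov lam (flow lam gam t p)) :=
    ⟨0, forall_mem_range.2 fun t ↦ (lyapunov_pos hv (flow_mem_interiorStates_iff.2 hp)).le⟩
  have hlim := tendsto_atBot_ciInf hmono.monotone hbdd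
  by_contra hne
  have hP := tendsto_flow_P_of_tendsto_lyapunov h hpc
    (fun s ↦ tendsto_atBot_add_const_left _ s tendsto_id) (fun h0 ↦ hne (h0 ▸ hlim)) hlim
  have hinf := tendsto_nhds_unique hlim (tendsto_lyapunov_P hv hpc hP)
  have hle := (hmono zero_lt_one).trans_le (lyapunov_le hv (flow_mem_closedStates_iff.2 hpc))
  exact (ciInf_le hbdd 0).not_gt (hinf ▸ hle)

theorem range_lyapunov_flow (h : Admissible lam gam) (hp : p ∈ interiorStates) :
    range (fun t ↦ lyapunov lam (flow lam gam t p)) = Ioo 0 (1 / (1 - sigmaP lam ^ 2)) :=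
  range_eq_Ioo_of_strictMono_of_tendsto (strictMono_lyapunov_flow h hp)
    (continuous_iff_continuousAt.2 fun t ↦ (hasDerivAt_lyapunov_flow h.abs_sigmaP_lt_one
      (interiorStates_subset_closedStates hp) t).continuousAt)
    (tendsto_lyapunov_flow_atBot h hp) (tendsto_lyapunov_flow_atTop h hp)

theorem tendsto_OmegaV_flow_atBot (h : Admissible lam gam) (hp : p ∈ interiorStates) :
    Tendsto (fun t ↦ OmegaV (flow lam gam t p)) atBot (𝓝 0) := by
  have hv := h.abs_sigmaP_lt_one
  have hpc := interiorStates_subset_closedStates hp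
  refine squeeze_zero (fun t ↦ (flow_mem_closedStates_iff.2 hpc).1) (fun t ↦ ?_)
    (by simpa only [zero_mul] using (tendsto_lyapunov_flow_atBot h hp).mul_const 4)
  have hmem : flow lam gam t p ∈ closedStates := flow_mem_closedStates_iff.2 hpc
  rw [← lyapunov_mul_sq hv hmem]
  have := abs_lt.1 (abs_sigmaP_mul_fst_lt_one hv hmem)
  gcongr
  · exact (lyapunov_pos hv (flow_mem_interiorStates_iff.2 hp)).le
  · nlinarith

end Lyapunov

section UnstableSets

variable {lam gam σ : ℝ} {p q κ κ' : State} {t : ℝ}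

theorem eq_of_forall_OmegaV_flow_eq_zero_of_le (hgam : gam < 2) (hσ : σ ^ 2 = 1) {m : ℝ}
    (hm : 0 < m) (hq : q ∈ closedStates) (hΩ : ∀ t, OmegaV (flow lam gam t q) = 0)
    (hle : ∀ t, m ≤ σ * (flow lam gam t q).1) : q = (σ, 0) := by
  have hmem (t) : flow lam gam t q ∈ closedStates := flow_mem_closedStates_iff.2 hq
  have hgrowth (t) : 3 * (2 - gam) * m ^ 2 * (flow lam gam t q).2 ≤
      (field lam gam (flow lam gam t q)).2 := by
    have hsq : m ^ 2 ≤ (flow lam gam t q).1 ^ 2 := by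
      have := pow_le_pow_left₀ hm.le (hle t) 2
      rwa [mul_pow, hσ, one_mul] at this
    calc 3 * (2 - gam) * m ^ 2 * (flow lam gam t q).2
        ≤ 3 * (2 - gam) * (flow lam gam t q).1 ^ 2 * (flow lam gam t q).2 := by
          have := (hmem t).2
          gcongr
      _ = (field lam gam (flow lam gam t q)).2 := by
          have := hΩ t
          rw [field_snd]
          unfold OmegaV at this
          linear_combination 3 * gam * (flow lam gam t q).2 * this
  have hnonpos := nonpos_of_mul_le_deriv_of_le (hasDerivAt_flow_snd hq)
    (by have := sub_pos.2 hgam; positivity) hgrowth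
    (fun t ↦ (le_abs_self _).trans ((norm_snd_le _).trans (norm_le_one (hmem t)))) 0
  have hpos := hm.trans_le (hle 0)
  have hΩ0 := hΩ 0
  rw [Flow.map_zero_apply] at hnonpos hpos hΩ0
  have hsnd := hnonpos.antisymm hq.2
  have hfst : q.1 ^ 2 = 1 := by
    unfold OmegaV at hΩ0
    linarith
  refine Prod.ext ?_ hsnd
  rcases sq_eq_sq_iff_eq_or_eq_neg.1 (hfst.trans hσ.symm) with h | h
  · exact h
  · rw [h] at hpos
    nlinarith

theorem eq_FL_of_forall_OmegaV_flow_eq_zero_of_le (hgam : gam < 2) {m : ℝ} (hm : m < 1)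
    (hq : q ∈ closedStates) (hΩ : ∀ t, OmegaV (flow lam gam t q) = 0)
    (hle : ∀ t, |(flow lam gam t q).1| ≤ m) : q = FL := by
  have hsq (t) : (flow lam gam t q).1 ^ 2 ≤ m ^ 2 :=
    sq_le_sq' (abs_le.1 (hle t)).1 (abs_le.1 (hle t)).2
  have hm2 : m ^ 2 < 1 := by nlinarith [(abs_nonneg _).trans (hle 0)]
  have hderiv (t) : HasDerivAt (fun t ↦ (flow lam gam (-t) q).1 ^ 2)
      (3 * (2 - gam) * (1 - (flow lam gam (-t) q).1 ^ 2) * (flow lam gam (-t) q).1 ^ 2) t := by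
    have := hΩ (-t)
    refine (((hasDerivAt_flow_fst hq (-t)).fun_pow 2).scomp t (hasDerivAt_neg t)).congr_deriv ?_
    rw [field_fst, this]
    unfold OmegaV at this
    simp only [smul_eq_mul]
    linear_combination -3 * (2 - gam) * (flow lam gam (-t) q).1 ^ 2 * this
  have hnonpos := nonpos_of_mul_le_deriv_of_le (c := 3 * (2 - gam) * (1 - m ^ 2)) (C := m ^ 2)
    hderiv (mul_pos (by linarith) (by linarith))
    (fun t ↦ by
      have := hsq (-t)
      gcongr) (fun t ↦ hsq (-t)) 0
  have hΩ0 := hΩ 0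
  rw [neg_zero, Flow.map_zero_apply] at hnonpos
  rw [Flow.map_zero_apply] at hΩ0
  have hfst : q.1 = 0 := pow_eq_zero_iff two_ne_zero |>.1 (hnonpos.antisymm (sq_nonneg _))
  refine Prod.ext hfst ?_
  rw [OmegaV, hfst] at hΩ0
  simp only [FL]
  linarith

theorem mul_field_fst_neg (hgam : gam < 2) (hσ : σ ^ 2 = 1) (hp : p ∈ interiorStates)
    (hlt : |sigmaP lam| < σ * p.1) : σ * (field lam gam p).1 < 0 := by
  have hσ' : |σ| = 1 := (abs_eq zero_le_one).2 (sq_eq_one_iff.1 hσ)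
  have hv : σ * sigmaP lam ≤ |sigmaP lam| := by
    simpa only [abs_mul, hσ', one_mul] using le_abs_self (σ * sigmaP lam)
  have h1 := mul_pos hp.1 (sub_pos.2 (hv.trans_lt hlt))
  have h2 := mul_pos (mul_pos (sub_pos.2 hgam) hp.2) ((abs_nonneg _).trans_lt hlt)
  rw [field_fst]
  linarith

theorem mul_fst_le_mul_flow_fst_of_nonpos (hgam : gam < 2) (hσ : σ ^ 2 = 1)
    (hp : p ∈ interiorStates) (hlt : |sigmaP lam| < σ * p.1) (ht : t ≤ 0) :
    σ * p.1 ≤ σ * (flow lam gam t p).1 := by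
  have hderiv (s) : HasDerivAt (fun s ↦ -(σ * (flow lam gam (-s) p).1))
      (σ * (field lam gam (flow lam gam (-s) p)).1) s :=
    (((hasDerivAt_flow_fst (interiorStates_subset_closedStates hp) (-s)).const_mul σ).scomp s
      (hasDerivAt_neg s)).neg.congr_deriv (by simp)
  have hle := image_le_of_deriv_right_lt_deriv_boundary (B := fun _ ↦ -(σ * p.1)) (a := 0) (b := -t)
    (fun s _ ↦ (hderiv s).continuousAt.continuousWithinAt)
    (fun s _ ↦ (hderiv s).hasDerivWithinAt) (by simp) (fun s ↦ hasDerivAt_const s _)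
    (fun s _ hs ↦ mul_field_fst_neg hgam hσ (flow_mem_interiorStates_iff.2 hp)
      (by rwa [neg_inj.1 hs]))
    (right_mem_Icc.2 (neg_nonneg.2 ht))
  simpa using hle

theorem tendsto_flow_atBot_of_abs_sigmaP_lt (h : Admissible lam gam) (hσ : σ ^ 2 = 1)
    (hp : p ∈ interiorStates) (hlt : |sigmaP lam| < σ * p.1) :
    Tendsto (flow lam gam · p) atBot (𝓝 (σ, 0)) := by
  have hK : IsCompact (closedStates ∩ {q | σ * p.1 ≤ σ * q.1}) :=
    isCompact_closedStates.inter_right (isClosed_le (by fun_prop) (by fun_prop))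
  refine tendsto_flow_of_unique_orbit_in_level _
    (fun s ↦ tendsto_atBot_add_const_left _ s tendsto_id) hK ?_
    continuous_OmegaV.continuousOn (tendsto_OmegaV_flow_atBot h hp) fun q hq ↦ ?_
  · filter_upwards [eventually_le_atBot 0] with t ht
    exact ⟨flow_mem_closedStates_iff.2 (interiorStates_subset_closedStates hp),
      mul_fst_le_mul_flow_fst_of_nonpos h.gam_lt_two hσ hp hlt ht⟩
  · exact eq_of_forall_OmegaV_flow_eq_zero_of_le h.gam_lt_two hσ ((abs_nonneg _).trans_lt hlt)
      (flow_mem_closedStates_iff.1 (hq 0).1.1) (fun t ↦ (hq t).2) fun t ↦ (hq t).1.2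

theorem tendsto_flow_atBot_FL_of_forall_abs_le (h : Admissible lam gam) (hp : p ∈ interiorStates)
    (hle : ∀ t, |(flow lam gam t p).1| ≤ |sigmaP lam|) :
    Tendsto (flow lam gam · p) atBot (𝓝 FL) := by
  have hK : IsCompact (closedStates ∩ {q | |q.1| ≤ |sigmaP lam|}) :=
    isCompact_closedStates.inter_right (isClosed_le (by fun_prop) (by fun_prop))
  refine tendsto_flow_of_unique_orbit_in_level _
    (fun s ↦ tendsto_atBot_add_const_left _ s tendsto_id) hK
    (.of_forall fun t ↦
      ⟨flow_mem_closedStates_iff.2 (interiorStates_subset_closedStates hp), hle t⟩)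
    continuous_OmegaV.continuousOn (tendsto_OmegaV_flow_atBot h hp) fun q hq ↦ ?_
  exact eq_FL_of_forall_OmegaV_flow_eq_zero_of_le h.gam_lt_two h.abs_sigmaP_lt_one
    (flow_mem_closedStates_iff.1 (hq 0).1.1) (fun t ↦ (hq t).2) fun t ↦ (hq t).1.2

/-- The part of the unstable set of `κ` in the interior state space. -/
def unstableSet (lam gam : ℝ) (κ : State) : Set State :=
  {p | p ∈ interiorStates ∧ Tendsto (flow lam gam · p) atBot (𝓝 κ)}

theorem flow_mem_unstableSet_iff :
    flow lam gam t p ∈ unstableSet lam gam κ ↔ p ∈ unstableSet lam gam κ :=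
  and_congr flow_mem_interiorStates_iff (tendsto_flow_apply_atBot_iff t)

theorem disjoint_unstableSet (hne : κ ≠ κ') :
    Disjoint (unstableSet lam gam κ) (unstableSet lam gam κ') :=
  disjoint_left.2 fun _ h h' ↦ hne (tendsto_nhds_unique h.2 h'.2)

theorem mem_unstableSet_iff_exists_abs_sigmaP_lt (h : Admissible lam gam) (hσ : σ ^ 2 = 1) :
    p ∈ unstableSet lam gam (σ, 0) ↔
      p ∈ interiorStates ∧ ∃ t, |sigmaP lam| < σ * (flow lam gam t p).1 := by
  refine and_congr_right fun hp ↦ ⟨fun hlim ↦ ?_, fun ⟨t, ht⟩ ↦ ?_⟩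
  · have hfst : Tendsto (fun t ↦ σ * (flow lam gam t p).1) atBot (𝓝 (σ * σ)) :=
      ((continuous_fst.tendsto _).comp hlim).const_mul σ
    rw [← sq, hσ] at hfst
    exact (hfst.eventually_const_lt h.abs_sigmaP_lt_one).exists
  · exact (tendsto_flow_apply_atBot_iff t).1
      (tendsto_flow_atBot_of_abs_sigmaP_lt h hσ (flow_mem_interiorStates_iff.2 hp) ht)

theorem isOpen_unstableSet (h : Admissible lam gam) (hσ : σ ^ 2 = 1) :
    IsOpen (unstableSet lam gam (σ, 0)) := by
  have hset : unstableSet lam gam (σ, 0) =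
      interiorStates ∩ ⋃ t, {p | |sigmaP lam| < σ * (flow lam gam t p).1} := by
    ext p
    simp only [mem_unstableSet_iff_exists_abs_sigmaP_lt h hσ, mem_inter_iff, mem_iUnion,
      mem_ofPred_eq]
  rw [hset]
  refine isOpen_interiorStates.inter (isOpen_iUnion fun t ↦ isOpen_lt continuous_const ?_)
  exact continuous_const.mul (continuous_fst.comp ((flow lam gam).continuous_toFun t))

theorem nonempty_unstableSet (h : Admissible lam gam) (hσ : σ ^ 2 = 1) :
    (unstableSet lam gam (σ, 0)).Nonempty := by
  obtain ⟨u, hvu, hu⟩ := exists_between h.abs_sigmaP_lt_one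
  have hu2 : u ^ 2 < 1 := by nlinarith [abs_nonneg (sigmaP lam)]
  have hp : (σ * u, (1 - u ^ 2) / 2) ∈ interiorStates := by
    constructor
    · simp only [OmegaV, mul_pow, hσ]
      linarith
    · change 0 < (1 - u ^ 2) / 2
      linarith
  refine ⟨_, hp, tendsto_flow_atBot_of_abs_sigmaP_lt h hσ hp ?_⟩
  rwa [← mul_assoc, ← sq, hσ, one_mul]

theorem mem_unstableSet_cases (h : Admissible lam gam) (hp : p ∈ interiorStates) :
    p ∈ unstableSet lam gam Kminus ∨ p ∈ unstableSet lam gam Kplus ∨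
      p ∈ unstableSet lam gam FL := by
  by_cases hle : ∀ t, |(flow lam gam t p).1| ≤ |sigmaP lam|
  · exact .inr (.inr ⟨hp, tendsto_flow_atBot_FL_of_forall_abs_le h hp hle⟩)
  push Not at hle
  obtain ⟨t, ht⟩ := hle
  rcases lt_abs.1 ht with ht | ht
  · exact .inr (.inl ((mem_unstableSet_iff_exists_abs_sigmaP_lt h (by norm_num)).2
      ⟨hp, t, by rwa [one_mul]⟩))
  · exact .inl ((mem_unstableSet_iff_exists_abs_sigmaP_lt h (by norm_num)).2
      ⟨hp, t, by rwa [neg_one_mul]⟩)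

end UnstableSets

section LevelCurves

variable {lam gam u z : ℝ} {p q : State} {t : ℝ}

/-- The level curve `lyapunov = z`, parametrized by `Σ_φ`. -/
noncomputable def levelCurve (lam z u : ℝ) : State :=
  (u, 1 - u ^ 2 - z * (1 - sigmaP lam * u) ^ 2)

theorem OmegaV_levelCurve (lam z u : ℝ) :
    OmegaV (levelCurve lam z u) = z * (1 - sigmaP lam * u) ^ 2 := by
  simp only [OmegaV, levelCurve]
  ring

theorem contDiff_levelCurve (lam : ℝ) : ContDiff ℝ 1 fun w : ℝ × ℝ ↦ levelCurve lam w.2 w.1 := by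
  unfold levelCurve
  fun_prop

theorem levelCurve_lyapunov (hv : |sigmaP lam| < 1) (hp : p ∈ closedStates) :
    levelCurve lam (lyapunov lam p) p.1 = p := by
  rw [levelCurve, lyapunov_mul_sq hv hp, OmegaV]
  ext <;> simp

theorem eq_of_fst_eq_of_lyapunov_eq (hv : |sigmaP lam| < 1) (hp : p ∈ closedStates)
    (hq : q ∈ closedStates) (hfst : p.1 = q.1) (hZ : lyapunov lam p = lyapunov lam q) : p = q := by
  rw [← levelCurve_lyapunov hv hp, ← levelCurve_lyapunov hv hq, hfst, hZ]

theorem lyapunov_levelCurve (hv : |sigmaP lam| < 1) (hmem : levelCurve lam z u ∈ closedStates) :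
    lyapunov lam (levelCurve lam z u) = z := by
  rw [lyapunov, OmegaV_levelCurve, levelCurve]
  exact mul_div_cancel_right₀ z (pow_ne_zero 2 (one_sub_sigmaP_mul_fst_pos hv hmem).ne')

theorem levelCurve_zero_zero (lam : ℝ) : levelCurve lam 0 0 = FL := by
  simp [levelCurve, FL]

/-- The slope `dΣ_φ / d(log lyapunov)` of the orbits, as a function of `(Σ_φ, lyapunov)`. -/
noncomputable def levelSlope (lam gam : ℝ) (w : ℝ × ℝ) : ℝ :=
  (field lam gam (levelCurve lam w.2 w.1)).1 / lyapunovRate lam gam (levelCurve lam w.2 w.1)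

theorem levelSlope_lyapunov (hv : |sigmaP lam| < 1) (hp : p ∈ closedStates) :
    levelSlope lam gam (p.1, lyapunov lam p) = (field lam gam p).1 / lyapunovRate lam gam p := by
  simp only [levelSlope, levelCurve_lyapunov hv hp]

theorem lyapunovRate_FL (lam gam : ℝ) : lyapunovRate lam gam FL = 3 * gam := by
  simp only [lyapunovRate, FL]
  ring

theorem contDiffAt_lyapunovRate_FL (lam gam : ℝ) : ContDiffAt ℝ 1 (lyapunovRate lam gam) FL :=
  (contDiffAt_const.div (by fun_prop) (by simp [FL])).mul (by fun_prop)

theorem eventually_lyapunovRate_pos_nhds_FL (hgam : 0 < gam) :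
    ∀ᶠ p in 𝓝 FL, 0 < lyapunovRate lam gam p :=
  (contDiffAt_lyapunovRate_FL lam gam).continuousAt.eventually_const_lt
    (by rw [lyapunovRate_FL]; positivity)

theorem contDiffAt_lyapunovRate_levelCurve_zero (lam gam : ℝ) :
    ContDiffAt ℝ 1 (fun w : ℝ × ℝ ↦ lyapunovRate lam gam (levelCurve lam w.2 w.1)) 0 := by
  have hFL := contDiffAt_lyapunovRate_FL lam gam
  rw [← levelCurve_zero_zero lam] at hFL
  exact hFL.comp (0 : ℝ × ℝ) (contDiff_levelCurve lam).contDiffAt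

theorem contDiffAt_levelSlope_zero (hgam : gam ≠ 0) : ContDiffAt ℝ 1 (levelSlope lam gam) 0 := by
  refine (contDiff_fst.comp ((contDiff_field lam gam).comp
    (contDiff_levelCurve lam))).contDiffAt.div
    (contDiffAt_lyapunovRate_levelCurve_zero lam gam) ?_
  simpa [levelCurve_zero_zero, lyapunovRate_FL] using hgam

theorem hasDerivAt_levelSlope_zero (hgam : gam ≠ 0) :
    HasDerivAt (fun u ↦ levelSlope lam gam (u, 0)) (-(2 - gam) / (2 * gam)) 0 := by
  have hnum : HasDerivAt (fun u ↦ (field lam gam (levelCurve lam 0 u)).1)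
      (-(3 / 2 * (2 - gam))) 0 := by
    have hpoly : (fun u ↦ (field lam gam (levelCurve lam 0 u)).1) =
        fun u ↦ -(3 / 2 * (2 - gam)) * (u - u ^ 3) := by
      ext u
      rw [field_fst, OmegaV_levelCurve, levelCurve]
      ring
    rw [hpoly]
    exact (((hasDerivAt_id' 0).fun_sub (hasDerivAt_pow 3 0)).const_mul _).congr_deriv (by simp)
  have hrate : DifferentiableAt ℝ (fun u ↦ lyapunovRate lam gam (levelCurve lam 0 u)) 0 :=
    ((contDiffAt_lyapunovRate_levelCurve_zero lam gam).differentiableAt one_ne_zero).comp (0 : ℝ)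
      (f := fun u : ℝ ↦ (u, (0 : ℝ))) (by fun_prop)
  have hrate0 : lyapunovRate lam gam (levelCurve lam 0 0) = 3 * gam := by
    rw [levelCurve_zero_zero, lyapunovRate_FL]
  refine (hnum.div hrate.hasDerivAt (by rw [hrate0]; positivity)).congr_deriv ?_
  have hfield0 : (field lam gam (levelCurve lam 0 0)).1 = 0 := by
    rw [field_fst, OmegaV_levelCurve, levelCurve]
    ring
  rw [hrate0, hfield0]
  field_simp
  ring

theorem eventually_sub_mul_levelSlope_sub_nonpos (h : Admissible lam gam) :
    ∀ᶠ w in 𝓝 ((0, 0) : (ℝ × ℝ) × ℝ × ℝ), w.1.2 = w.2.2 →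
      (w.1.1 - w.2.1) * (levelSlope lam gam w.1 - levelSlope lam gam w.2) ≤ 0 := by
  have hstrict := (contDiffAt_levelSlope_zero (lam := lam) h.gam_pos.ne').hasStrictFDerivAt
    one_ne_zero
  refine eventually_sub_mul_sub_nonpos_of_hasStrictFDerivAt hstrict ?_
  have hpair : HasDerivAt (fun u : ℝ ↦ (u, (0 : ℝ))) (1, 0) 0 :=
    (hasDerivAt_id' 0).prodMk (hasDerivAt_const ..)
  have hslope := (hasDerivAt_levelSlope_zero h.gam_pos.ne').unique
    (hstrict.hasFDerivAt.comp_hasDerivAt (0 : ℝ) (f := fun u : ℝ ↦ (u, (0 : ℝ))) hpair)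
  rw [← hslope]
  exact div_neg_of_neg_of_pos (by linarith [h.gam_lt_two]) (by linarith [h.gam_pos])

theorem exists_orderIso_lyapunov_flow_eq (h : Admissible lam gam) (hp : p ∈ interiorStates)
    (hq : q ∈ interiorStates) :
    ∃ τ : ℝ ≃o ℝ, ∀ t, lyapunov lam (flow lam gam (τ t) q) = lyapunov lam (flow lam gam t p) := by
  obtain ⟨τ, hτ⟩ := exists_orderIso_comp_eq_of_strictMono (strictMono_lyapunov_flow h hp)
    (strictMono_lyapunov_flow h hq)
    ((range_lyapunov_flow h hp).trans (range_lyapunov_flow h hq).symm)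
  exact ⟨τ, congrFun hτ⟩

theorem hasDerivAt_flow_fst_sub_flow_fst (hv : |sigmaP lam| < 1) (hp : p ∈ interiorStates)
    (hq : q ∈ interiorStates) {τ : ℝ ≃o ℝ}
    (hτ : ∀ t, lyapunov lam (flow lam gam (τ t) q) = lyapunov lam (flow lam gam t p))
    (hpt : lyapunovRate lam gam (flow lam gam t p) ≠ 0)
    (hqt : lyapunovRate lam gam (flow lam gam (τ t) q) ≠ 0) :
    HasDerivAt (fun t ↦ (flow lam gam t p).1 - (flow lam gam (τ t) q).1)
      (lyapunovRate lam gam (flow lam gam t p) *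
        (levelSlope lam gam ((flow lam gam t p).1, lyapunov lam (flow lam gam t p)) -
          levelSlope lam gam
            ((flow lam gam (τ t) q).1, lyapunov lam (flow lam gam (τ t) q)))) t := by
  have hpc := interiorStates_subset_closedStates hp
  have hqc := interiorStates_subset_closedStates hq
  have hZ : lyapunov lam (flow lam gam t p) ≠ 0 :=
    (lyapunov_pos hv (flow_mem_interiorStates_iff.2 hp)).ne'
  have hderiv : HasDerivAt τ (lyapunovRate lam gam (flow lam gam t p) /
      lyapunovRate lam gam (flow lam gam (τ t) q)) t := by
    refine (hasDerivAt_div_of_comp_eq τ.continuous.continuousAt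
      (hasDerivAt_lyapunov_flow hv hqc (τ t)) (hasDerivAt_lyapunov_flow hv hpc t)
      (mul_ne_zero (by rwa [hτ]) hqt) (.of_forall hτ)).congr_deriv ?_
    rw [hτ, mul_div_mul_left _ _ hZ]
  refine ((hasDerivAt_flow_fst hpc t).fun_sub
    ((hasDerivAt_flow_fst hqc (τ t)).scomp t hderiv)).congr_deriv ?_
  rw [levelSlope_lyapunov hv (flow_mem_closedStates_iff.2 hpc),
    levelSlope_lyapunov hv (flow_mem_closedStates_iff.2 hqc), smul_eq_mul]
  field_simp

theorem eventually_flow_eq_flow_of_mem_unstableSet_FL (h : Admissible lam gam)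
    (hp : p ∈ unstableSet lam gam FL) (hq : q ∈ unstableSet lam gam FL) {τ : ℝ ≃o ℝ}
    (hτ : ∀ t, lyapunov lam (flow lam gam (τ t) q) = lyapunov lam (flow lam gam t p)) :
    ∀ᶠ t in atBot, flow lam gam (τ t) q = flow lam gam t p := by
  obtain ⟨hp, hpFL⟩ := hp
  obtain ⟨hq, hqFL⟩ := hq
  have hv := h.abs_sigmaP_lt_one
  have hqFL' := hqFL.comp τ.tendsto_atBot
  have hrate := eventually_lyapunovRate_pos_nhds_FL (lam := lam) h.gam_pos
  have hp0 := ((continuous_fst.tendsto _).comp hpFL).prodMk_nhds (tendsto_lyapunov_flow_atBot h hp)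
  have hq0 := ((continuous_fst.tendsto _).comp hqFL').prodMk_nhds
    ((tendsto_lyapunov_flow_atBot h hq).comp τ.tendsto_atBot)
  have hfst := eventually_eq_zero_of_mul_deriv_nonpos
    (f := fun t ↦ (flow lam gam t p).1 - (flow lam gam (τ t) q).1)
    (by
      filter_upwards [hpFL.eventually hrate, hqFL'.eventually hrate] with t hpt hqt
      exact hasDerivAt_flow_fst_sub_flow_fst hv hp hq hτ hpt.ne' hqt.ne')
    (by
      filter_upwards [hpFL.eventually hrate,
        (hp0.prodMk_nhds hq0).eventually (eventually_sub_mul_levelSlope_sub_nonpos h)] with t hpt ht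
      rw [mul_left_comm]
      exact mul_nonpos_of_nonneg_of_nonpos hpt.le (ht (hτ t).symm))
    (by simpa using hp0.fst_nhds.sub hq0.fst_nhds)
  filter_upwards [hfst] with t ht
  exact eq_of_fst_eq_of_lyapunov_eq hv
    (flow_mem_closedStates_iff.2 (interiorStates_subset_closedStates hq))
    (flow_mem_closedStates_iff.2 (interiorStates_subset_closedStates hp))
    (sub_eq_zero.1 ht).symm (hτ t)

theorem mem_orbit_of_mem_unstableSet_FL (h : Admissible lam gam)
    (hp : p ∈ unstableSet lam gam FL) (hq : q ∈ unstableSet lam gam FL) :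
    q ∈ (flow lam gam).orbit p := by
  obtain ⟨τ, hτ⟩ := exists_orderIso_lyapunov_flow_eq h hp.1 hq.1
  obtain ⟨t, ht⟩ := (eventually_flow_eq_flow_of_mem_unstableSet_FL h hp hq hτ).exists
  refine ⟨-τ t + t, ?_⟩
  change flow lam gam (-τ t + t) p = q
  rw [Flow.map_add, ← ht, ← Flow.map_add, neg_add_cancel, Flow.map_zero_apply]

end LevelCurves

section CrossSection

variable {lam gam u z : ℝ} {p : State}

theorem exists_setOf_levelCurve_mem_interiorStates_eq_Ioo (hv : |sigmaP lam| < 1) (hz : 0 < z) :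
    ∃ a b, {u | levelCurve lam z u ∈ interiorStates} = Ioo a b := by
  have hA : 0 < 1 + z * sigmaP lam ^ 2 := by positivity
  set c := z * sigmaP lam / (1 + z * sigmaP lam ^ 2) with hc
  set R := c ^ 2 + (1 - z) / (1 + z * sigmaP lam ^ 2) with hR
  have hsquare (u : ℝ) :
      (levelCurve lam z u).2 = (1 + z * sigmaP lam ^ 2) * (R - (u - c) ^ 2) := by
    rw [levelCurve, hR, hc]
    field_simp
    ring
  have hsnd (u : ℝ) : 0 < (levelCurve lam z u).2 ↔ u ∈ Ioo (c - √R) (c + √R) := by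
    rw [hsquare, mul_pos_iff_of_pos_left hA, sub_pos, Real.sq_lt, mem_Ioo]
    constructor <;> rintro ⟨h1, h2⟩ <;> constructor <;> linarith
  have hOmegaV (u : ℝ) (hu : 0 < (levelCurve lam z u).2) : 0 < OmegaV (levelCurve lam z u) := by
    have hclosed : levelCurve lam z u ∈ closedStates :=
      ⟨by rw [OmegaV_levelCurve]; positivity, hu.le⟩
    have := one_sub_sigmaP_mul_fst_pos hv hclosed
    rw [OmegaV_levelCurve]
    exact mul_pos hz (pow_pos this 2)
  refine ⟨c - √R, c + √R, ?_⟩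
  ext u
  exact ⟨fun hu ↦ (hsnd u).1 hu.2, fun hu ↦ ⟨hOmegaV u ((hsnd u).2 hu), (hsnd u).2 hu⟩⟩

/-- A cross-section to the interior orbits, the level curve `lyapunov = 1 / 2`; the level `1 / 2` is
chosen because every interior orbit passes through all levels in `(0, 1)`. -/
noncomputable def crossSection (lam : ℝ) : ℝ → State := levelCurve lam (1 / 2)

theorem continuous_crossSection (lam : ℝ) : Continuous (crossSection lam) := by
  unfold crossSection levelCurve
  fun_prop

theorem existsUnique_crossSection_mem_orbit (h : Admissible lam gam) (hp : p ∈ interiorStates) :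
    ∃! u, crossSection lam u ∈ (flow lam gam).orbit p := by
  have hv := h.abs_sigmaP_lt_one
  have hpc := interiorStates_subset_closedStates hp
  have hZ : (1 / 2 : ℝ) ∈ range fun t ↦ lyapunov lam (flow lam gam t p) := by
    rw [range_lyapunov_flow h hp]
    have hv2 := (sq_lt_one_iff_abs_lt_one _).2 hv
    exact ⟨by norm_num,
      one_div_lt_one_div_of_lt (by linarith) (by linarith [sq_nonneg (sigmaP lam)])⟩
  obtain ⟨t, ht⟩ := hZ
  have hsec : crossSection lam (flow lam gam t p).1 = flow lam gam t p := by
    rw [crossSection, ← ht]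
    exact levelCurve_lyapunov hv (flow_mem_closedStates_iff.2 hpc)
  refine ⟨_, hsec ▸ (flow lam gam).mem_orbit p t, fun u hu ↦ ?_⟩
  obtain ⟨s, hs : flow lam gam s p = crossSection lam u⟩ := hu
  have hmem : crossSection lam u ∈ closedStates := hs ▸ flow_mem_closedStates_iff.2 hpc
  have hZs : lyapunov lam (flow lam gam s p) = 1 / 2 := by
    rw [hs]
    exact lyapunov_levelCurve hv hmem
  obtain rfl : s = t := (strictMono_lyapunov_flow h hp).injective (hZs.trans ht.symm)
  exact (congrArg Prod.fst hs).symm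

end CrossSection

section InteriorOrbits

variable {lam gam σ a b : ℝ} {κ : State}

theorem exists_crossSection_preimage_unstableSet_union_eq_Ioo (h : Admissible lam gam) :
    ∃ a b, crossSection lam ⁻¹' unstableSet lam gam Kminus ∪
      crossSection lam ⁻¹' unstableSet lam gam Kplus ∪
      crossSection lam ⁻¹' unstableSet lam gam FL = Ioo a b := by
  obtain ⟨a, b, hab⟩ := exists_setOf_levelCurve_mem_interiorStates_eq_Ioo h.abs_sigmaP_lt_one
    (z := 1 / 2) (by norm_num)
  refine ⟨a, b, hab ▸ Subset.antisymm ?_ fun u hu ↦ ?_⟩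
  · exact union_subset (union_subset (fun _ hu ↦ hu.1) fun _ hu ↦ hu.1) fun _ hu ↦ hu.1
  · exact or_assoc.2 (mem_unstableSet_cases h hu)

theorem isOpen_crossSection_preimage_unstableSet (h : Admissible lam gam) (hσ : σ ^ 2 = 1) :
    IsOpen (crossSection lam ⁻¹' unstableSet lam gam (σ, 0)) :=
  (isOpen_unstableSet h hσ).preimage (continuous_crossSection lam)

theorem nonempty_crossSection_preimage_unstableSet (h : Admissible lam gam) (hσ : σ ^ 2 = 1) :
    (crossSection lam ⁻¹' unstableSet lam gam (σ, 0)).Nonempty := by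
  obtain ⟨p, hp⟩ := nonempty_unstableSet h hσ
  obtain ⟨u, ⟨t, ht : flow lam gam t p = crossSection lam u⟩, -⟩ :=
    existsUnique_crossSection_mem_orbit h hp.1
  exact ⟨u, mem_preimage.2 (ht ▸ flow_mem_unstableSet_iff.2 hp)⟩

theorem subsingleton_crossSection_preimage_unstableSet_FL (h : Admissible lam gam) :
    (crossSection lam ⁻¹' unstableSet lam gam FL).Subsingleton := fun _ hu _ hu' ↦
  (existsUnique_crossSection_mem_orbit h hu.1).unique ((flow lam gam).mem_orbit_self _)
    (mem_orbit_of_mem_unstableSet_FL h hu hu')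

theorem exists_crossSection_preimage_unstableSet_eq (h : Admissible lam gam) :
    ∃ c, crossSection lam ⁻¹' unstableSet lam gam FL = {c} ∧
      (∃ a b, a < b ∧ crossSection lam ⁻¹' unstableSet lam gam Kminus = Ioo a b) ∧
      ∃ a b, a < b ∧ crossSection lam ⁻¹' unstableSet lam gam Kplus = Ioo a b := by
  obtain ⟨a, b, hunion⟩ := exists_crossSection_preimage_unstableSet_union_eq_Ioo h
  obtain ⟨c, ⟨hac, hcb⟩, hFL, ⟨hminus, hplus⟩ | ⟨hminus, hplus⟩⟩ := exists_Ioo_split hunion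
    (isOpen_crossSection_preimage_unstableSet h (by norm_num))
    (isOpen_crossSection_preimage_unstableSet h (by norm_num))
    (nonempty_crossSection_preimage_unstableSet h (by norm_num))
    (nonempty_crossSection_preimage_unstableSet h (by norm_num))
    ((disjoint_unstableSet (by norm_num [Kminus, Kplus])).preimage _)
    ((disjoint_unstableSet (by norm_num [Kminus, FL])).preimage _)
    ((disjoint_unstableSet (by norm_num [Kplus, FL])).preimage _)
    (subsingleton_crossSection_preimage_unstableSet_FL h)
  · exact ⟨c, hFL, ⟨a, c, hac, hminus⟩, c, b, hcb, hplus⟩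
  · exact ⟨c, hFL, ⟨c, b, hcb, hminus⟩, a, c, hac, hplus⟩

theorem setOf_isInteriorOrbit_and_originatesFrom (lam gam : ℝ) (κ : State) :
    {O | IsInteriorOrbit lam gam O ∧ OriginatesFrom lam gam O κ} =
      (flow lam gam).orbit '' unstableSet lam gam κ := by
  ext O
  constructor
  · rintro ⟨hO, hκ⟩
    obtain ⟨p, hp, rfl⟩ := isInteriorOrbit_iff.1 hO
    exact ⟨p, ⟨hp, (originatesFrom_orbit_iff hp).1 hκ⟩, rfl⟩
  · rintro ⟨p, hp, rfl⟩
    exact ⟨isInteriorOrbit_iff.2 ⟨p, hp.1, rfl⟩, (originatesFrom_orbit_iff hp.1).2 hp.2⟩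

theorem isOneParameterSet_of_crossSection_preimage_eq_Ioo (h : Admissible lam gam) (hab : a < b)
    (hset : crossSection lam ⁻¹' unstableSet lam gam κ = Ioo a b) :
    IsOneParameterSet {O | IsInteriorOrbit lam gam O ∧ OriginatesFrom lam gam O κ} := by
  obtain ⟨e, he, hinj, hrange⟩ := exists_continuous_injective_range_eq_Ioo hab
  rw [setOf_isInteriorOrbit_and_originatesFrom]
  refine ⟨crossSection lam ∘ e, (continuous_crossSection lam).comp he, fun s ↦ ?_, ?_⟩
  · have hs : e s ∈ crossSection lam ⁻¹' unstableSet lam gam κ := by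
      rw [hset, ← hrange]
      exact mem_range_self s
    exact ⟨_, ⟨_, hs, rfl⟩, (flow lam gam).mem_orbit_self _⟩
  · rintro _ ⟨p, hp, rfl⟩
    obtain ⟨u, hu, huniq⟩ := existsUnique_crossSection_mem_orbit h hp.1
    obtain ⟨s, rfl⟩ : u ∈ range e := by
      obtain ⟨t, ht : flow lam gam t p = crossSection lam u⟩ := hu
      rw [hrange, ← hset, mem_preimage, ← ht]
      exact flow_mem_unstableSet_iff.2 hp
    exact ⟨s, hu, fun s' hs' ↦ hinj (huniq _ hs')⟩

theorem existsUnique_isInteriorOrbit_originatesFrom_FL (h : Admissible lam gam)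
    (hne : (unstableSet lam gam FL).Nonempty) :
    ∃! O, IsInteriorOrbit lam gam O ∧ OriginatesFrom lam gam O FL := by
  obtain ⟨p, hp⟩ := hne
  refine ⟨(flow lam gam).orbit p,
    ⟨isInteriorOrbit_iff.2 ⟨p, hp.1, rfl⟩, (originatesFrom_orbit_iff hp.1).2 hp.2⟩, ?_⟩
  rintro O ⟨hO, hFL⟩
  obtain ⟨q, hq, rfl⟩ := isInteriorOrbit_iff.1 hO
  exact (flow lam gam).toAddAction.orbit_eq_iff.2
    (mem_orbit_of_mem_unstableSet_FL h hp ⟨hq, (originatesFrom_orbit_iff hq).1 hFL⟩)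

theorem endsAt_P_of_isInteriorOrbit (h : Admissible lam gam) {O : Set State}
    (hO : IsInteriorOrbit lam gam O) : EndsAt lam gam O (P lam) := by
  obtain ⟨p, hp, rfl⟩ := isInteriorOrbit_iff.1 hO
  have hp' := interiorStates_subset_closedStates hp
  exact endsAt_orbit_of_tendsto hp' (tendsto_flow_atTop_P h hp)

theorem originatesFrom_cases (h : Admissible lam gam) {O : Set State}
    (hO : IsInteriorOrbit lam gam O) :
    OriginatesFrom lam gam O Kminus ∨ OriginatesFrom lam gam O Kplus ∨
      OriginatesFrom lam gam O FL := by
  obtain ⟨p, hp, rfl⟩ := isInteriorOrbit_iff.1 hO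
  simp only [originatesFrom_orbit_iff hp]
  exact (mem_unstableSet_cases h hp).imp And.right (Or.imp And.right And.right)

theorem P_zero : P 0 = dS := by
  simp [P, dS]

theorem P_eq_S_sq_div_three {lam : ℝ} (hlam : lam ≠ 0) : P lam = S lam (lam ^ 2 / 3) := by
  have hfst : √(3 / 2) * (lam ^ 2 / 3 / lam) = sigmaP lam := by
    calc √(3 / 2) * (lam ^ 2 / 3 / lam) = √(3 / 2) * lam / 3 := by field_simp
      _ = sigmaP lam := by rw [sqrt_mul_eq_three_mul_sigmaP]; ring
  have hsnd : 1 - 3 * (lam ^ 2 / 3) / lam ^ 2 = 0 := by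
    field_simp
    norm_num
  exact Prod.ext hfst.symm hsnd.symm

end InteriorOrbits

end ScalarFluid

open ScalarFluid in
theorem theorem1 (lam gam : ℝ) (hgam : gam ∈ Set.Ioo (0 : ℝ) 2) (h : lam ^ 2 / 3 ≤ gam) :
    -- the interior is partitioned into interior orbits, all of them complete
    (∀ p ∈ interiorStates, ∃! O : Set State, IsInteriorOrbit lam gam O ∧ p ∈ O) ∧
    -- (i)
    ((∀ O : Set State, IsInteriorOrbit lam gam O → EndsAt lam gam O (P lam)) ∧
      (lam = 0 → P lam = dS) ∧ (gam = lam ^ 2 / 3 → P lam = S lam gam)) ∧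
    -- (ii)
    (∃! O : Set State, IsInteriorOrbit lam gam O ∧ OriginatesFrom lam gam O FL) ∧
    -- (iii)
    ((∀ O : Set State, IsInteriorOrbit lam gam O → ¬ OriginatesFrom lam gam O FL →
        OriginatesFrom lam gam O Kminus ∨ OriginatesFrom lam gam O Kplus) ∧
      IsOneParameterSet {O | IsInteriorOrbit lam gam O ∧ OriginatesFrom lam gam O Kminus} ∧
      IsOneParameterSet {O | IsInteriorOrbit lam gam O ∧ OriginatesFrom lam gam O Kplus}) := by
  have hA : Admissible lam gam := ⟨hgam.1, hgam.2, by rw [sigmaP_sq]; linarith⟩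
  obtain ⟨c, hFL, ⟨a, b, hab, hminus⟩, a', b', hab', hplus⟩ :=
    exists_crossSection_preimage_unstableSet_eq hA
  refine ⟨fun p hp ↦ existsUnique_isInteriorOrbit_mem lam gam hp,
    ⟨fun O hO ↦ endsAt_P_of_isInteriorOrbit hA hO, ?_, ?_⟩,
    existsUnique_isInteriorOrbit_originatesFrom_FL hA ⟨crossSection lam c, hFL.ge rfl⟩,
    fun O hO hne ↦ ?_,
    isOneParameterSet_of_crossSection_preimage_eq_Ioo hA hab hminus,
    isOneParameterSet_of_crossSection_preimage_eq_Ioo hA hab' hplus⟩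
  · rintro rfl
    exact P_zero
  · rintro rfl
    refine P_eq_S_sq_div_three ?_
    rintro rfl
    norm_num at hgam
  · exact (originatesFrom_cases hA hO).imp_right fun hO' ↦ hO'.resolve_right hne
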